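/- Let $n,N\ge 0$ be integers, let $H$ be a complex Hilbert space and let $\varphi:\mathbb C^n\to B(H)$ be an injective linear map. Let $V$ be $\mathbb C^n$ with the norm $\|z\|_V=\|\varphi(z)\|$, let $E=(V,\varphi)$ be the operator space with matrix norms $\|(A_1,\dots,A_n)\|_{E}=\big\|\sum_{j}A_j\otimes\varphi(e_j)\big\|$ for $n$-tuples of complex $k\times l$ matrices ($k,l$ arbitrary, the sum acting from $H^l$ to $H^k$), and let $\Omega=\{z\in\mathbb C^n:\|z\|_V<1\}$. (Up to the choice of a basis, every finite-dimensional operator space is of this form.) The dual operator space $E^*$ is $\mathbb C^n$, paired with $E$ by $\langle z,w\rangle=\sum_j z_jw_j$, with matrix norms $\|A\|_{E^*}=\sup\big\|\sum_j A_j\otimes B_j\big\|$, the supremum over all $n$-tuples $B$ of complex $r\times s$ matrices ($r,s$ arbitrary) with $\|B\|_E\le1$. For a Hilbert space $K$, a linear map $\sigma:\mathbb C^n\to B(K)$ is completely contractive for $E$ (respectively $E^*$) if $\big\|\sum_jA_j\otimes\sigma(e_j)\big\|\le\|A\|_E$ (respectively $\le\|A\|_{E^*}$) for all $n$-tuples $A$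 of complex $k\times l$ matrices and all $k,l$. For $S=(S_1,\dots,S_n)\in B(K)^n$ put $\sigma_S(z)=\sum_jz_jS_j$. Let $p=\sum_\alpha P_\alpha z^\alpha$ be a polynomial in $n$ variables with coefficients $P_\alpha\in M_N(\mathbb C)$, and for commuting $S$ put $p(S)=\sum_\alpha P_\alpha\otimes S^\alpha\in M_N\otimes B(K)=B(K^N)$. Then the following are equivalent: (1) (Agler–Nevanlinna factorization) There are a Hilbert space $K$, a map $\sigma:\mathbb C^n\to B(K)$ that is completely contractive for $E$, and an analytic function $F:\Omega\to B(K,\mathbb C^N)$ such that $I-p(z)p(w)^*=F(z)\,[\,I_K-\sigma(z)\sigma(w)^*\,]\,F(w)^*$ for all $z,w\in\Omega$. (2) (Transfer function realization) There are a Hilbert space $K'$, a unitary operator $U=\begin{pmatrix}A&B\\ C&D\end{pmatrix}$ on $K'\oplus\mathbb C^N$, and a map $\sigma:\mathbb C^n\to B(K')$ that is completely contractive for $E$, such that for all $z\in\Omega$ the operator $I-\sigma(z)A$ is invertible and $p(z)=D+C(I-\sigma(z)A)^{-1}\sigma(z)B$. (3) (von Neumann inequality) For every Hilbert space $K$ and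 every $n$-tuple $S$ of pairwise commuting operators in $B(K)$ such that $\sigma_S$ is completely contractive for $E^*$, one has $\|p(S)\|\le1$. -/

import Mathlib

open scoped Kronecker

universe u v

noncomputable section

namespace OpSpace

variable {n : ℕ} {H : Type v} [NormedAddCommGroup H] [InnerProductSpace ℂ H]

/-- The bounded operator from the Hilbert direct sum `H^l` to `H^k` given by a `k × l` matrix of
bounded operators on `H`: `(x_j)_j ↦ (∑ j, M i j (x_j))_i`. -/
def opMatrix {k l : ℕ} (M : Matrix (Fin k) (Fin l) (H →L[ℂ] H)) :
    PiLp 2 (fun _ : Fin l => H) →L[ℂ] PiLp 2 (fun _ : Fin k => H) :=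
  ((PiLp.continuousLinearEquiv 2 ℂ (fun _ : Fin k => H)).symm :
      (Fin k → H) →L[ℂ] PiLp 2 (fun _ : Fin k => H)) ∘L
    ContinuousLinearMap.pi (fun i => ∑ j, M i j ∘L PiLp.proj 2 (fun _ : Fin l => H) j)

theorem opMatrix_apply {k l : ℕ} (M : Matrix (Fin k) (Fin l) (H →L[ℂ] H))
    (x : PiLp 2 (fun _ : Fin l => H)) (i : Fin k) :
    opMatrix M x i = ∑ j, M i j (x j) := by
  simp [opMatrix]

/-- `∑ t, A t ⊗ T t` as an operator from `H^l` to `H^k`, for an `n`-tuple `A` of scalar `k × l`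
matrices and an `n`-tuple `T` of operators on `H`. -/
def tensorSum {k l : ℕ} (A : Fin n → Matrix (Fin k) (Fin l) ℂ) (T : Fin n → H →L[ℂ] H) :
    PiLp 2 (fun _ : Fin l => H) →L[ℂ] PiLp 2 (fun _ : Fin k => H) :=
  opMatrix (Matrix.of fun i j => ∑ t, A t i j • T t)

/-- The data of a real number for each `k × l` matrix over `ℂ^n` (all `k`, `l`); such a matrix is
presented as an `n`-tuple of scalar `k × l` matrices. -/
abbrev MatrixNorms (n : ℕ) : Type :=
  (k l : ℕ) → (Fin n → Matrix (Fin k) (Fin l) ℂ) → ℝ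

/-- The matrix norms of the operator space structure on `ℂ^n` determined by `φ : ℂ^n → B(H)`:
the norm of `(A_1, …, A_n)` is `‖∑ t, A_t ⊗ φ(e_t)‖`. -/
def matrixNorms (φ : (Fin n → ℂ) →ₗ[ℂ] (H →L[ℂ] H)) : MatrixNorms n :=
  fun _ _ A => ‖tensorSum A (fun t => φ (Pi.single t 1))‖

open scoped Matrix.Norms.L2Operator in
/-- The matrix norms of the dual operator space, `ℂ^n` being paired with itself by
`⟨z, w⟩ = ∑ j, z_j w_j`: the norm of `A` is the completely bounded norm of the map
`z ↦ ∑ t, z_t A_t` into scalar matrices, that is, the supremum of `‖∑ t, A_t ⊗ B_t‖` over all `B`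
in the closed unit balls of the given matrix norms (scalar matrices carry the operator norm between
Euclidean spaces). -/
def dualNorms (μ : MatrixNorms n) : MatrixNorms n :=
  fun _ _ A => sSup {c : ℝ | ∃ (r s : ℕ) (B : Fin n → Matrix (Fin r) (Fin s) ℂ),
    μ r s B ≤ 1 ∧ c = ‖∑ t, A t ⊗ₖ B t‖}

/-- A linear map `ψ : ℂ^n → B(H)` is completely contractive for the matrix norms `μ` if
`‖∑ t, A_t ⊗ ψ(e_t)‖ ≤ μ(A)` for all tuples of scalar matrices `A`. -/
def CompletelyContractive (μ : MatrixNorms n) (ψ : (Fin n → ℂ) →ₗ[ℂ] (H →L[ℂ] H)) : Prop :=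
  ∀ (k l : ℕ) (A : Fin n → Matrix (Fin k) (Fin l) ℂ),
    ‖tensorSum A (fun t => ψ (Pi.single t 1))‖ ≤ μ k l A

/-- The open unit ball of the Banach space `V = (ℂ^n, z ↦ ‖φ z‖)`. -/
def unitBall (φ : (Fin n → ℂ) →ₗ[ℂ] (H →L[ℂ] H)) : Set (Fin n → ℂ) :=
  {z | ‖φ z‖ < 1}

/-- The linear map `σ_S(z) = ∑ j, z_j S_j`. -/
def tupleMap (S : Fin n → H →L[ℂ] H) : (Fin n → ℂ) →ₗ[ℂ] (H →L[ℂ] H) :=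
  Fintype.linearCombination ℂ S

/-- The value `q(S)` of a scalar polynomial at a tuple of operators; the tuples in use commute, so
that the order of the factors in a monomial is irrelevant. -/
def polyOp (q : MvPolynomial (Fin n) ℂ) (S : Fin n → H →L[ℂ] H) : H →L[ℂ] H :=
  ∑ α ∈ q.support, q.coeff α • (List.ofFn fun j => S j ^ α j).prod

/-- The value `p(z)` of an `M_N`-valued polynomial, as an operator on the Hilbert space `ℂ^N`. -/
def matPolyEval {N : ℕ} (p : Matrix (Fin N) (Fin N) (MvPolynomial (Fin n) ℂ)) (z : Fin n → ℂ) :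
    EuclideanSpace ℂ (Fin N) →L[ℂ] EuclideanSpace ℂ (Fin N) :=
  Matrix.toEuclideanCLM (n := Fin N) (𝕜 := ℂ) (p.map (MvPolynomial.eval z))

/-- The value `p(S)` of an `M_N`-valued polynomial at a tuple of operators on `H`, an element of
`M_N ⊗ B(H) = B(H^N)`. -/
def matPolyOp {N : ℕ} (p : Matrix (Fin N) (Fin N) (MvPolynomial (Fin n) ℂ))
    (S : Fin n → H →L[ℂ] H) : PiLp 2 (fun _ : Fin N => H) →L[ℂ] PiLp 2 (fun _ : Fin N => H) :=
  opMatrix (p.map fun q => polyOp q S)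

end OpSpace

end

noncomputable section

namespace OpSpace

open scoped ComplexConjugate

/-! ### Norms of tensor sums, in coordinates -/

section TensorSum

variable {n k l : ℕ} {K : Type*} [NormedAddCommGroup K] [InnerProductSpace ℂ K]

theorem tensorSum_apply (A : Fin n → Matrix (Fin k) (Fin l) ℂ) (T : Fin n → K →L[ℂ] K)
    (x : PiLp 2 (fun _ : Fin l => K)) (i : Fin k) :
    tensorSum A T x i = ∑ t, ∑ j, A t i j • T t (x j) := by
  simp only [tensorSum, opMatrix_apply, Matrix.of_apply, sum_apply,
    smul_apply]
  exact Finset.sum_comm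

theorem norm_tensorSum_nonneg (A : Fin n → Matrix (Fin k) (Fin l) ℂ) (T : Fin n → K →L[ℂ] K) :
    0 ≤ ‖tensorSum A T‖ :=
  ContinuousLinearMap.opNorm_nonneg _

/-- In this form contractivity speaks only of finite families of vectors, and so passes to
compressions, Gram matrices and closures. -/
theorem norm_tensorSum_le_iff (A : Fin n → Matrix (Fin k) (Fin l) ℂ) (T : Fin n → K →L[ℂ] K)
    {c : ℝ} (hc : 0 ≤ c) :
    ‖tensorSum A T‖ ≤ c ↔ ∀ x : Fin l → K,
      ∑ i, ‖∑ t, ∑ j, A t i j • T t (x j)‖ ^ 2 ≤ c ^ 2 * ∑ j, ‖x j‖ ^ 2 := by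
  rw [ContinuousLinearMap.opNorm_le_iff hc]
  refine ⟨fun h x => ?_, fun h x => ?_⟩
  · have := pow_le_pow_left₀ (norm_nonneg _) (h (WithLp.toLp 2 x)) 2
    rw [mul_pow, PiLp.norm_sq_eq_of_L2, PiLp.norm_sq_eq_of_L2] at this
    simpa only [tensorSum_apply] using this
  · refine le_of_sq_le_sq ?_ (by positivity)
    rw [mul_pow, PiLp.norm_sq_eq_of_L2, PiLp.norm_sq_eq_of_L2]
    simpa only [tensorSum_apply] using h (WithLp.ofLp x)

theorem adjoint_tensorSum [CompleteSpace K] (A : Fin n → Matrix (Fin k) (Fin l) ℂ)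
    (T : Fin n → K →L[ℂ] K) :
    (tensorSum A T).adjoint = tensorSum (fun t => (A t).conjTranspose) fun t => (T t).adjoint := by
  symm
  rw [ContinuousLinearMap.eq_adjoint_iff]
  intro x y
  simp only [PiLp.inner_apply, tensorSum_apply, sum_inner, inner_sum, Matrix.conjTranspose_apply,
    inner_smul_left, inner_smul_right, ContinuousLinearMap.adjoint_inner_left]
  rw [Finset.sum_comm]
  conv_rhs => rw [Finset.sum_comm]
  refine Finset.sum_congr rfl fun t _ => ?_
  rw [Finset.sum_comm]
  simp

/-- The adjoint form is needed because `σ` and `S` are later constructed through their adjoints. -/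
theorem norm_tensorSum_le_iff_adjoint [CompleteSpace K] (A : Fin n → Matrix (Fin k) (Fin l) ℂ)
    (T : Fin n → K →L[ℂ] K) {c : ℝ} (hc : 0 ≤ c) :
    ‖tensorSum A T‖ ≤ c ↔ ∀ x : Fin k → K,
      ∑ j, ‖∑ t, ∑ i, conj (A t i j) • (T t).adjoint (x i)‖ ^ 2 ≤ c ^ 2 * ∑ i, ‖x i‖ ^ 2 := by
  rw [← LinearIsometryEquiv.norm_map ContinuousLinearMap.adjoint (tensorSum A T),
    adjoint_tensorSum, norm_tensorSum_le_iff _ _ hc]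
  simp only [Matrix.conjTranspose_apply, RCLike.star_def]

theorem norm_tensorSum_scalar (z : Fin n → ℂ) (T : Fin n → K →L[ℂ] K) :
    ‖tensorSum (fun t => Matrix.of fun (_ _ : Fin 1) => z t) T‖ = ‖∑ t, z t • T t‖ := by
  refine le_antisymm ?_ ?_
  · rw [norm_tensorSum_le_iff _ _ (norm_nonneg _)]
    intro x
    have := (∑ t, z t • T t).le_opNorm (x 0)
    have := pow_le_pow_left₀ (norm_nonneg _) this 2
    simpa [mul_pow] using this
  · refine ContinuousLinearMap.opNorm_le_bound _ (norm_tensorSum_nonneg _ _) fun x => ?_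
    have := (norm_tensorSum_le_iff (fun t => Matrix.of fun (_ _ : Fin 1) => z t) T
      (norm_tensorSum_nonneg _ _)).1 le_rfl fun _ => x
    refine le_of_sq_le_sq ?_ (by positivity)
    simpa [mul_pow] using this

theorem norm_tensorSum_smul_le (c : ℂ) (A : Fin n → Matrix (Fin k) (Fin l) ℂ)
    (T : Fin n → K →L[ℂ] K) : ‖tensorSum (fun t => c • A t) T‖ ≤ ‖c‖ * ‖tensorSum A T‖ := by
  rw [norm_tensorSum_le_iff _ _ (mul_nonneg (norm_nonneg _) (norm_tensorSum_nonneg _ _))]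
  intro x
  have := (norm_tensorSum_le_iff A T (norm_tensorSum_nonneg _ _)).1 le_rfl x
  simp only [Matrix.smul_apply, smul_eq_mul, mul_smul, ← Finset.smul_sum, norm_smul, mul_pow,
    ← Finset.mul_sum]
  rw [mul_assoc]
  gcongr

theorem map_eq_sum_single (ψ : (Fin n → ℂ) →ₗ[ℂ] (K →L[ℂ] K)) (z : Fin n → ℂ) :
    ψ z = ∑ t, z t • ψ (Pi.single t 1) := by
  conv_lhs => rw [← Finset.univ_sum_single z]
  rw [map_sum]
  refine Finset.sum_congr rfl fun t _ => ?_
  rw [← map_smul, ← Pi.single_smul, smul_eq_mul, mul_one]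

end TensorSum

/-! ### Operator norm of Kronecker products -/

section Kronecker

variable {ι₁ ι₂ κ₁ κ₂ : Type*} [Fintype ι₁] [Fintype ι₂] [Fintype κ₁] [Fintype κ₂]
  [DecidableEq ι₂] [DecidableEq κ₂]

open scoped Matrix.Norms.L2Operator in
theorem l2_opNorm_le_iff (A : Matrix ι₁ ι₂ ℂ) {c : ℝ} (hc : 0 ≤ c) :
    ‖A‖ ≤ c ↔ ∀ x : ι₂ → ℂ, ∑ i, ‖∑ j, A i j * x j‖ ^ 2 ≤ c ^ 2 * ∑ j, ‖x j‖ ^ 2 := by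
  rw [Matrix.l2_opNorm_def, ContinuousLinearMap.opNorm_le_iff hc]
  refine ⟨fun h x => ?_, fun h x => ?_⟩
  · have := pow_le_pow_left₀ (norm_nonneg _) (h (WithLp.toLp 2 x)) 2
    rw [mul_pow, EuclideanSpace.norm_sq_eq, EuclideanSpace.norm_sq_eq] at this
    simpa [Matrix.mulVec, dotProduct] using this
  · refine le_of_sq_le_sq ?_ (by positivity)
    rw [mul_pow, EuclideanSpace.norm_sq_eq, EuclideanSpace.norm_sq_eq]
    simpa [Matrix.mulVec, dotProduct] using h (WithLp.ofLp x)

open scoped Matrix.Norms.L2Operator in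
-- The two factors act on separate indices, so the bounds for `A` and `B` are applied one after the
-- other.
theorem l2_opNorm_kronecker_le (A : Matrix ι₁ ι₂ ℂ) (B : Matrix κ₁ κ₂ ℂ) :
    ‖A ⊗ₖ B‖ ≤ ‖A‖ * ‖B‖ := by
  have hA := (l2_opNorm_le_iff A (norm_nonneg _)).1 le_rfl
  have hB := (l2_opNorm_le_iff B (norm_nonneg _)).1 le_rfl
  rw [l2_opNorm_le_iff _ (by positivity)]
  intro x
  rw [Fintype.sum_prod_type, Fintype.sum_prod_type, Finset.sum_comm]
  calc ∑ a', ∑ a, ‖∑ j : ι₂ × κ₂, (A ⊗ₖ B) (a, a') j * x j‖ ^ 2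
      = ∑ a', ∑ a, ‖∑ b, A a b * ∑ b', B a' b' * x (b, b')‖ ^ 2 := by
        simp only [Fintype.sum_prod_type, Matrix.kroneckerMap_apply, Finset.mul_sum, mul_assoc]
    _ ≤ ∑ a', ‖A‖ ^ 2 * ∑ b, ‖∑ b', B a' b' * x (b, b')‖ ^ 2 :=
        Finset.sum_le_sum fun a' _ => hA _
    _ = ‖A‖ ^ 2 * ∑ b, ∑ a', ‖∑ b', B a' b' * x (b, b')‖ ^ 2 := by
        rw [← Finset.mul_sum, Finset.sum_comm]
    _ ≤ ‖A‖ ^ 2 * ∑ b, ‖B‖ ^ 2 * ∑ b', ‖x (b, b')‖ ^ 2 := by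
        gcongr with b
        exact hB _
    _ = _ := by rw [← Finset.mul_sum]; ring

end Kronecker

/-! ### Matrix norms of `E` and of its dual -/

section MatrixNorms

variable {n k l : ℕ} {H : Type v} [NormedAddCommGroup H] [InnerProductSpace ℂ H]

theorem matrixNorms_scalar (φ : (Fin n → ℂ) →ₗ[ℂ] (H →L[ℂ] H)) (z : Fin n → ℂ) :
    matrixNorms φ 1 1 (fun t => Matrix.of fun _ _ => z t) = ‖φ z‖ := by
  rw [matrixNorms, norm_tensorSum_scalar, ← map_eq_sum_single]

theorem matrixNorms_nonneg (φ : (Fin n → ℂ) →ₗ[ℂ] (H →L[ℂ] H))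
    (A : Fin n → Matrix (Fin k) (Fin l) ℂ) : 0 ≤ matrixNorms φ k l A :=
  norm_tensorSum_nonneg _ _

open scoped Matrix.Norms.L2Operator in
theorem dualNorms_nonneg (μ : MatrixNorms n) (A : Fin n → Matrix (Fin k) (Fin l) ℂ) :
    0 ≤ dualNorms μ k l A := by
  refine Real.sSup_nonneg ?_
  rintro _ ⟨r, s, B, -, rfl⟩
  exact norm_nonneg _

theorem CompletelyContractive.norm_le {φ : (Fin n → ℂ) →ₗ[ℂ] (H →L[ℂ] H)} {K : Type*}
    [NormedAddCommGroup K] [InnerProductSpace ℂ K] {σ : (Fin n → ℂ) →ₗ[ℂ] (K →L[ℂ] K)}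
    (hσ : CompletelyContractive (matrixNorms φ) σ) (z : Fin n → ℂ) : ‖σ z‖ ≤ ‖φ z‖ := by
  have := hσ 1 1 fun t => Matrix.of fun _ _ => z t
  rwa [matrixNorms_scalar, norm_tensorSum_scalar, ← map_eq_sum_single] at this

/-- The scalars `y* A_t x` are compressions of the tuple `A` to one-dimensional subspaces. -/
theorem norm_map_compression_le (φ : (Fin n → ℂ) →ₗ[ℂ] (H →L[ℂ] H))
    (A : Fin n → Matrix (Fin k) (Fin l) ℂ) (x : EuclideanSpace ℂ (Fin l))
    (y : EuclideanSpace ℂ (Fin k)) :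
    ‖φ (fun t => ∑ i, ∑ j, conj (y i) * A t i j * x j)‖ ≤ matrixNorms φ k l A * ‖x‖ * ‖y‖ := by
  refine ContinuousLinearMap.opNorm_le_bound _
    (mul_nonneg (mul_nonneg (matrixNorms_nonneg φ A) (norm_nonneg _)) (norm_nonneg _)) fun h => ?_
  have h1 := (norm_tensorSum_le_iff A (fun t => φ (Pi.single t 1)) (norm_tensorSum_nonneg _ _)).1 le_rfl
    fun j => x j • h
  have h2 : φ (fun t => ∑ i, ∑ j, conj (y i) * A t i j * x j) h =
      ∑ i, conj (y i) • ∑ t, ∑ j, A t i j • φ (Pi.single t 1) (x j • h) := by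
    rw [map_eq_sum_single]
    simp only [sum_apply, smul_apply, Finset.sum_smul,
      Finset.smul_sum, map_smul, smul_smul]
    rw [Finset.sum_comm]
    refine Finset.sum_congr rfl fun i _ => Finset.sum_congr rfl fun t _ =>
      Finset.sum_congr rfl fun j _ => ?_
    rw [mul_assoc]
  rw [h2]
  set w : Fin k → H := fun i => ∑ t, ∑ j, A t i j • φ (Pi.single t 1) (x j • h) with hw
  have h3 : ‖∑ i, conj (y i) • w i‖ ≤ ∑ i, ‖y i‖ * ‖w i‖ := by
    refine (norm_sum_le _ _).trans (le_of_eq (Finset.sum_congr rfl fun i _ => ?_))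
    rw [norm_smul, RCLike.norm_conj]
  have h4 := Finset.sum_mul_sq_le_sq_mul_sq Finset.univ (fun i => ‖y i‖) fun i => ‖w i‖
  refine h3.trans (le_of_sq_le_sq (h4.trans ?_) (mul_nonneg (mul_nonneg (mul_nonneg
    (matrixNorms_nonneg φ A) (norm_nonneg _)) (norm_nonneg _)) (norm_nonneg _)))
  rw [← EuclideanSpace.norm_sq_eq]
  have h5 : ∑ j, ‖x j • h‖ ^ 2 = ‖x‖ ^ 2 * ‖h‖ ^ 2 := by
    rw [EuclideanSpace.norm_sq_eq, Finset.sum_mul]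
    exact Finset.sum_congr rfl fun j _ => by rw [norm_smul, mul_pow]
  rw [h5] at h1
  calc ‖y‖ ^ 2 * ∑ i, ‖w i‖ ^ 2 ≤ ‖y‖ ^ 2 * (‖tensorSum A fun t => φ (Pi.single t 1)‖ ^ 2 *
      (‖x‖ ^ 2 * ‖h‖ ^ 2)) := by gcongr
    _ = _ := by rw [matrixNorms]; ring

open scoped Matrix.Norms.L2Operator in
-- In finite dimensions an injective `φ` is bounded below, so the scalars `y* A_t x`, the
-- coordinates of a vector in `V`, are controlled by its norm there; the supremum over unit `x`, `y`
-- is `‖A t‖`.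
theorem exists_norm_le_matrixNorms {φ : (Fin n → ℂ) →ₗ[ℂ] (H →L[ℂ] H)}
    (hφ : Function.Injective φ) : ∃ c : ℝ, 0 ≤ c ∧ ∀ (k l : ℕ)
      (A : Fin n → Matrix (Fin k) (Fin l) ℂ) (t : Fin n), ‖A t‖ ≤ c * matrixNorms φ k l A := by
  obtain ⟨c, -, hc⟩ := LinearMap.exists_antilipschitzWith φ (LinearMap.ker_eq_bot.2 hφ)
  refine ⟨c, c.2, fun k l A t => ?_⟩
  rw [Matrix.l2_opNorm_def]
  refine ContinuousLinearMap.opNorm_le_of_re_inner_le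
    (mul_nonneg c.2 (matrixNorms_nonneg φ A)) fun x y hx hy => ?_
  have h1 := norm_map_compression_le φ A x y
  rw [hx, hy, mul_one, mul_one] at h1
  have h2 := hc.le_mul_norm (map_zero φ) (fun t => ∑ i, ∑ j, conj (y i) * A t i j * x j)
  have h3 := (norm_le_pi_norm (fun t => ∑ i, ∑ j, conj (y i) * A t i j * x j) t).trans
    (h2.trans (mul_le_mul_of_nonneg_left h1 c.2))
  refine le_trans (le_of_eq ?_) ((RCLike.abs_re_le_norm _).trans h3) |>.trans' (le_abs_self _)
  rw [← inner_conj_symm, RCLike.conj_re]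
  congr 2
  simp [PiLp.inner_apply, Matrix.mulVec, dotProduct, Finset.mul_sum, mul_comm, mul_left_comm, mul_assoc]

open scoped Matrix.Norms.L2Operator in
-- Without boundedness the real `sSup` in `dualNorms` would take the default value `0`; injectivity
-- of `φ` enters here.
theorem bddAbove_dualNorms {φ : (Fin n → ℂ) →ₗ[ℂ] (H →L[ℂ] H)} (hφ : Function.Injective φ)
    (A : Fin n → Matrix (Fin k) (Fin l) ℂ) :
    BddAbove {c : ℝ | ∃ (r s : ℕ) (B : Fin n → Matrix (Fin r) (Fin s) ℂ),
      matrixNorms φ r s B ≤ 1 ∧ c = ‖∑ t, A t ⊗ₖ B t‖} := by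
  obtain ⟨c, hc0, hc⟩ := exists_norm_le_matrixNorms hφ
  refine ⟨∑ t, ‖A t‖ * c, ?_⟩
  rintro _ ⟨r, s, B, hB, rfl⟩
  refine norm_sum_le_of_le _ fun t _ => (l2_opNorm_kronecker_le _ _).trans ?_
  gcongr
  exact (hc r s B t).trans (mul_le_of_le_one_right hc0 hB)

open scoped Matrix.Norms.L2Operator in
theorem norm_kronecker_le_dualNorms {φ : (Fin n → ℂ) →ₗ[ℂ] (H →L[ℂ] H)}
    (hφ : Function.Injective φ) (A : Fin n → Matrix (Fin k) (Fin l) ℂ) {r s : ℕ}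
    (B : Fin n → Matrix (Fin r) (Fin s) ℂ) :
    ‖∑ t, A t ⊗ₖ B t‖ ≤ dualNorms (matrixNorms φ) k l A * matrixNorms φ r s B := by
  have hd := dualNorms_nonneg (matrixNorms φ) A
  have hm := matrixNorms_nonneg φ B
  -- Normalizing by `matrixNorms φ r s B + ε` avoids division by zero; then `ε → 0`.
  have key : ∀ ε : ℝ, 0 < ε →
      ‖∑ t, A t ⊗ₖ B t‖ ≤ dualNorms (matrixNorms φ) k l A * (matrixNorms φ r s B + ε) := by
    intro ε hε
    have hpos : 0 < matrixNorms φ r s B + ε := by positivity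
    set q : ℂ := ((matrixNorms φ r s B + ε : ℝ) : ℂ)⁻¹ with hq
    have hqn : ‖q‖ = (matrixNorms φ r s B + ε)⁻¹ := by
      rw [hq, norm_inv, Complex.norm_real, Real.norm_of_nonneg hpos.le]
    have h1 : matrixNorms φ r s (fun t => q • B t) ≤ 1 := by
      refine (norm_tensorSum_smul_le _ _ _).trans ?_
      rw [hqn, inv_mul_le_iff₀ hpos, mul_one]
      exact le_add_of_nonneg_right hε.le
    have h2 := le_csSup (bddAbove_dualNorms hφ A) ⟨r, s, fun t => q • B t, h1, rfl⟩
    have h3 : ∑ t, A t ⊗ₖ (q • B t) = q • ∑ t, A t ⊗ₖ B t := by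
      simp only [Matrix.kronecker_smul, Finset.smul_sum]
    rw [h3, norm_smul, hqn, inv_mul_le_iff₀ hpos, mul_comm] at h2
    exact h2
  have ht : Filter.Tendsto (fun ε : ℝ => dualNorms (matrixNorms φ) k l A * (matrixNorms φ r s B + ε))
      (nhdsWithin 0 (Set.Ioi 0)) (nhds (dualNorms (matrixNorms φ) k l A *
        (matrixNorms φ r s B + 0))) :=
    (Continuous.tendsto (by fun_prop) 0).mono_left nhdsWithin_le_nhds
  rw [add_zero] at ht
  exact ge_of_tendsto ht (by filter_upwards [self_mem_nhdsWithin] with ε hε using key ε hε)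

end MatrixNorms

/-! ### Isometries, partial isometries and unitary dilations -/

section HilbertSpace

theorem withLp_prod_ext {X Y : Type*} {x y : WithLp 2 (X × Y)} (h₁ : x.fst = y.fst)
    (h₂ : x.snd = y.snd) : x = y :=
  WithLp.ofLp_injective 2 (Prod.ext h₁ h₂)

theorem withLp_prod_inner {X Y : Type*} [NormedAddCommGroup X] [InnerProductSpace ℂ X]
    [NormedAddCommGroup Y] [InnerProductSpace ℂ Y] (x y : WithLp 2 (X × Y)) :
    inner ℂ x y = inner ℂ x.fst y.fst + inner ℂ x.snd y.snd :=
  rfl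

/-- A positive semidefinite Hermitian form on a complex vector space is the pull-back of the inner
product of a Hilbert space. -/
theorem exists_hilbertSpace_of_core {V : Type u} [AddCommGroup V] [Module ℂ V]
    (c : PreInnerProductSpace.Core ℂ V) :
    ∃ (K : Type u) (_ : NormedAddCommGroup K) (_ : InnerProductSpace ℂ K) (_ : CompleteSpace K)
      (f : V →ₗ[ℂ] K), DenseRange f ∧ ∀ x y, inner ℂ (f x) (f y) = c.inner x y := by
  let _ : SeminormedAddCommGroup V := @InnerProductSpace.Core.toSeminormedAddCommGroup ℂ V _ _ _ c
  let _ : InnerProductSpace ℂ V := InnerProductSpace.ofCore c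
  exact ⟨UniformSpace.Completion V, inferInstance, inferInstance, inferInstance,
    (UniformSpace.Completion.toComplₗᵢ (𝕜 := ℂ) (E := V)).toLinearMap,
    UniformSpace.Completion.denseRange_coe, fun x y => UniformSpace.Completion.inner_coe x y⟩

variable {V : Type*} [AddCommGroup V] [Module ℂ V]
  {X : Type*} [NormedAddCommGroup X] [InnerProductSpace ℂ X] [CompleteSpace X]
  {Y : Type*} [NormedAddCommGroup Y] [InnerProductSpace ℂ Y] [CompleteSpace Y]

/-- An operator prescribed on a subspace, extended by zero on the orthogonal complement. -/
theorem exists_extension_by_zero (a : V →ₗ[ℂ] X) (b : V →ₗ[ℂ] Y) {C : ℝ}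
    (h : ∀ v, ‖b v‖ ≤ C * ‖a v‖) :
    ∃ T : X →L[ℂ] Y, (∀ v, T (a v) = b v) ∧
      ∀ x, T ((LinearMap.range a).topologicalClosure.starProjection x) = T x := by
  set M := (LinearMap.range a).topologicalClosure with hM
  have hmem : ∀ v, a v ∈ M := fun v => Submodule.le_topologicalClosure _ ⟨v, rfl⟩
  have : CompleteSpace M := Submodule.topologicalClosure.completeSpace _
  let e : V →ₗ[ℂ] M := a.codRestrict M hmem
  have hd : DenseRange e := by
    intro x
    rw [closure_subtype]
    have : Subtype.val '' Set.range e = LinearMap.range a := by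
      ext y
      simp only [Set.mem_image, Set.mem_range, exists_exists_eq_and, LinearMap.coe_range]
      rfl
    rw [this]
    exact x.2
  have hn : ∀ v, ‖b v‖ ≤ C * ‖e v‖ := h
  refine ⟨b.extendOfNorm e ∘L M.orthogonalProjectionOnto, fun v => ?_, fun x => ?_⟩
  · have : M.orthogonalProjectionOnto (a v) = e v :=
      Submodule.orthogonalProjectionOnto_mem_subspace_eq_self (⟨a v, hmem v⟩ : M)
    rw [ContinuousLinearMap.comp_apply, this, LinearMap.extendOfNorm_eq hd ⟨C, hn⟩]
  · have : M.orthogonalProjectionOnto (M.starProjection x) = M.orthogonalProjectionOnto x :=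
      Submodule.orthogonalProjectionOnto_mem_subspace_eq_self (M.orthogonalProjectionOnto x)
    rw [ContinuousLinearMap.comp_apply, this, ContinuousLinearMap.comp_apply]

/-- The map `a v ↦ b v` is isometric on the closure of the range of `a` and is extended by zero.
Hence `T* T` is the projection onto that closure, which yields the remaining claims. -/
theorem exists_partialIsometry (a : V →ₗ[ℂ] X) (b : V →ₗ[ℂ] Y) (h : ∀ v, ‖b v‖ = ‖a v‖) :
    ∃ T : X →L[ℂ] Y, (∀ v, T (a v) = b v) ∧ (∀ v, T.adjoint (b v) = a v) ∧
      (∀ x, T (T.adjoint (T x)) = T x) := by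
  obtain ⟨T, hT, hTP⟩ := exists_extension_by_zero a b (C := 1) fun v => by rw [one_mul, h v]
  set M := (LinearMap.range a).topologicalClosure with hM
  have hmem : ∀ v, a v ∈ M := fun v => Submodule.le_topologicalClosure _ ⟨v, rfl⟩
  have hiso : ∀ x ∈ M, ‖T x‖ = ‖x‖ := by
    intro x hx
    refine closure_minimal (s := (LinearMap.range a : Set X)) (t := {x | ‖T x‖ = ‖x‖}) ?_
      (isClosed_eq (by fun_prop) (by fun_prop)) hx
    rintro _ ⟨v, rfl⟩
    exact (congrArg norm (hT v)).trans (h v)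
  let S : M →ₗᵢ[ℂ] Y := ⟨T.toLinearMap ∘ₗ M.subtype, fun x => hiso x x.2⟩
  have hin : ∀ x ∈ M, ∀ y ∈ M, inner ℂ (T x) (T y) = inner ℂ x y := fun x hx y hy =>
    S.inner_map_map ⟨x, hx⟩ ⟨y, hy⟩
  have hTT : ∀ x, T.adjoint (T x) = M.starProjection x := by
    intro x
    refine ext_inner_right ℂ fun y => ?_
    rw [ContinuousLinearMap.adjoint_inner_left, ← hTP x, ← hTP y,
      hin _ (M.starProjection_apply_mem x) _ (M.starProjection_apply_mem y),
      ← M.inner_starProjection_left_eq_right,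
      Submodule.starProjection_eq_self_iff.2 (M.starProjection_apply_mem x)]
  refine ⟨T, hT, fun v => ?_, fun x => ?_⟩
  · rw [← hT, hTT, Submodule.starProjection_eq_self_iff.2 (hmem v)]
  · rw [hTT, hTP]

theorem exists_linearIsometryEquiv_of_adjoint {E : Type*} [NormedAddCommGroup E]
    [InnerProductSpace ℂ E] (f g : E →ₗ[ℂ] E) (hfg : f ∘ₗ g = LinearMap.id)
    (hgf : g ∘ₗ f = LinearMap.id) (hadj : ∀ x y, inner ℂ (f x) y = inner ℂ x (g y)) :
    ∃ U : E ≃ₗᵢ[ℂ] E, ∀ x, U x = f x :=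
  ⟨(LinearEquiv.ofLinearMap f g hfg hgf).isometryOfInner fun x y => by
    refine (hadj x (f y)).trans ?_
    exact congrArg (inner ℂ x) (LinearMap.congr_fun hgf y), fun x => rfl⟩

/-- Halmos dilation of a partial isometry. -/
theorem exists_unitary_dilation (a b : V →ₗ[ℂ] X) (h : ∀ v, ‖b v‖ = ‖a v‖) :
    ∃ U : WithLp 2 (X × X) ≃ₗᵢ[ℂ] WithLp 2 (X × X),
      ∀ v, U (WithLp.toLp 2 (a v, 0)) = WithLp.toLp 2 (b v, 0) := by
  obtain ⟨T, hT, hT', hTT⟩ := exists_partialIsometry a b h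
  have hTT' : ∀ x, T.adjoint (T (T.adjoint x)) = T.adjoint x := by
    intro x
    refine ext_inner_right ℂ fun y => ?_
    rw [ContinuousLinearMap.adjoint_inner_left, ← ContinuousLinearMap.adjoint_inner_right,
      ContinuousLinearMap.adjoint_inner_left, hTT, ContinuousLinearMap.adjoint_inner_left]
  -- The Halmos matrix with rows `(T, 1 - T T*)` and `(1 - T* T, -T*)`. Since `T` is a partial
  -- isometry the defect operators are projections and need no square roots. `g` is both its adjoint
  -- and its inverse.
  let f : WithLp 2 (X × X) →ₗ[ℂ] WithLp 2 (X × X) :=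
    { toFun := fun x => WithLp.toLp 2 (T x.fst + (x.snd - T (T.adjoint x.snd)),
        (x.fst - T.adjoint (T x.fst)) - T.adjoint x.snd)
      map_add' := fun x y => by
        refine withLp_prod_ext ?_ ?_ <;> simp <;> abel
      map_smul' := fun c x => by
        refine withLp_prod_ext ?_ ?_ <;> simp [smul_sub, smul_add] }
  let g : WithLp 2 (X × X) →ₗ[ℂ] WithLp 2 (X × X) :=
    { toFun := fun x => WithLp.toLp 2 (T.adjoint x.fst + (x.snd - T.adjoint (T x.snd)),
        (x.fst - T (T.adjoint x.fst)) - T x.snd)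
      map_add' := fun x y => by
        refine withLp_prod_ext ?_ ?_ <;> simp <;> abel
      map_smul' := fun c x => by
        refine withLp_prod_ext ?_ ?_ <;> simp [smul_sub, smul_add] }
  obtain ⟨U, hU⟩ := exists_linearIsometryEquiv_of_adjoint f g
    (LinearMap.ext fun x => withLp_prod_ext (by simp [f, g, hTT, hTT']) (by simp [f, g, hTT, hTT'])) (LinearMap.ext fun x => withLp_prod_ext (by simp [f, g, hTT, hTT']) (by simp [f, g, hTT, hTT']))
    (fun x y => by
      have : inner ℂ (T (T.adjoint x.snd)) y.fst = inner ℂ x.snd (T (T.adjoint y.fst)) := by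
        rw [← ContinuousLinearMap.adjoint_inner_right, ContinuousLinearMap.adjoint_inner_left]
      simp only [f, g, LinearMap.coe_mk, AddHom.coe_mk, withLp_prod_inner, inner_add_left,
        WithLp.toLp_fst, WithLp.toLp_snd, this,
        inner_add_right, inner_sub_left, inner_sub_right, ContinuousLinearMap.adjoint_inner_left,
        ContinuousLinearMap.adjoint_inner_right]
      ring)
  refine ⟨U, fun v => ?_⟩
  rw [hU]
  refine withLp_prod_ext ?_ ?_ <;> simp [f, hT, hT']

/-- The isometric isomorphism `(X ⊕ Y) ⊕ Z ≃ (X ⊕ Z) ⊕ Y`. -/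
theorem exists_prod_shuffle (X Y Z : Type*) [NormedAddCommGroup X] [InnerProductSpace ℂ X]
    [NormedAddCommGroup Y] [InnerProductSpace ℂ Y] [NormedAddCommGroup Z]
    [InnerProductSpace ℂ Z] :
    ∃ W : WithLp 2 (WithLp 2 (X × Y) × Z) ≃ₗᵢ[ℂ] WithLp 2 (WithLp 2 (X × Z) × Y),
      ∀ x y z, W (WithLp.toLp 2 (WithLp.toLp 2 (x, y), z)) =
        WithLp.toLp 2 (WithLp.toLp 2 (x, z), y) := by
  let f : WithLp 2 (WithLp 2 (X × Y) × Z) →ₗ[ℂ] WithLp 2 (WithLp 2 (X × Z) × Y) :=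
    { toFun := fun x => WithLp.toLp 2 (WithLp.toLp 2 (x.fst.fst, x.snd), x.fst.snd)
      map_add' := fun x y => rfl
      map_smul' := fun c x => rfl }
  let g : WithLp 2 (WithLp 2 (X × Z) × Y) →ₗ[ℂ] WithLp 2 (WithLp 2 (X × Y) × Z) :=
    { toFun := fun x => WithLp.toLp 2 (WithLp.toLp 2 (x.fst.fst, x.snd), x.fst.snd)
      map_add' := fun x y => rfl
      map_smul' := fun c x => rfl }
  refine ⟨(LinearEquiv.ofLinearMap f g rfl rfl).isometryOfInner fun x y => ?_, fun x y z => rfl⟩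
  have h : inner ℂ (f x) (f y) = (inner ℂ x.fst.fst y.fst.fst + inner ℂ x.snd y.snd) +
      inner ℂ x.fst.snd y.fst.snd := rfl
  refine h.trans ?_
  rw [withLp_prod_inner x y, withLp_prod_inner x.fst y.fst]
  ring

/-- The dilation space is regrouped so that only the state space `X` grows, while the input and
output space `Z` stays the same. -/
theorem exists_unitary_of_isometric {Z : Type*} [NormedAddCommGroup Z] [InnerProductSpace ℂ Z]
    [CompleteSpace Z] (a b : V →ₗ[ℂ] WithLp 2 (X × Z)) (h : ∀ v, ‖b v‖ = ‖a v‖) :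
    ∃ U : WithLp 2 (WithLp 2 (X × WithLp 2 (X × Z)) × Z) ≃ₗᵢ[ℂ]
        WithLp 2 (WithLp 2 (X × WithLp 2 (X × Z)) × Z),
      ∀ v, U (WithLp.toLp 2 (WithLp.toLp 2 ((a v).fst, 0), (a v).snd)) =
        WithLp.toLp 2 (WithLp.toLp 2 ((b v).fst, 0), (b v).snd) := by
  obtain ⟨U, hU⟩ := exists_unitary_dilation a b h
  obtain ⟨W, hW⟩ := exists_prod_shuffle X (WithLp 2 (X × Z)) Z
  refine ⟨(W.trans U).trans W.symm, fun v => ?_⟩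
  rw [LinearIsometryEquiv.trans_apply, LinearIsometryEquiv.trans_apply, hW,
    LinearIsometryEquiv.symm_apply_eq, hW]
  exact hU v

end HilbertSpace

/-! ### Factorization and transfer function realization -/

section Realization

variable {n : ℕ} {H : Type v} [NormedAddCommGroup H] [InnerProductSpace ℂ H]

/-- Used with an inclusion `J` and the projection `Q`, to extend `σ` by zero to an enlarged state
space. -/
theorem CompletelyContractive.conj {μ : MatrixNorms n} {K L : Type*} [NormedAddCommGroup K]
    [InnerProductSpace ℂ K] [NormedAddCommGroup L] [InnerProductSpace ℂ L]
    {σ : (Fin n → ℂ) →ₗ[ℂ] (K →L[ℂ] K)} (hσ : CompletelyContractive μ σ)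
    {τ : (Fin n → ℂ) →ₗ[ℂ] (L →L[ℂ] L)} (J : K →L[ℂ] L) (Q : L →L[ℂ] K) (hJ : ‖J‖ ≤ 1)
    (hQ : ‖Q‖ ≤ 1) (hτ : ∀ z x, τ z x = J (σ z (Q x))) : CompletelyContractive μ τ := by
  intro k l A
  have hA := hσ k l A
  have h0 := (norm_tensorSum_nonneg _ _).trans hA
  rw [norm_tensorSum_le_iff _ _ h0] at hA ⊢
  intro x
  calc ∑ i, ‖∑ t, ∑ j, A t i j • τ (Pi.single t 1) (x j)‖ ^ 2
      = ∑ i, ‖J (∑ t, ∑ j, A t i j • σ (Pi.single t 1) (Q (x j)))‖ ^ 2 := by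
        simp only [hτ, map_sum, map_smul]
    _ ≤ ∑ i, ‖∑ t, ∑ j, A t i j • σ (Pi.single t 1) (Q (x j))‖ ^ 2 := by
        gcongr with i
        exact J.le_of_opNorm_le hJ _ |>.trans_eq (one_mul _)
    _ ≤ μ k l A ^ 2 * ∑ j, ‖Q (x j)‖ ^ 2 := hA _
    _ ≤ _ := by
        gcongr with j
        exact Q.le_of_opNorm_le hQ _ |>.trans_eq (one_mul _)

theorem norm_linearCombination_eq {ι X Y : Type*} [NormedAddCommGroup X] [InnerProductSpace ℂ X]
    [NormedAddCommGroup Y] [InnerProductSpace ℂ Y] {a : ι → X} {b : ι → Y}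
    (h : ∀ i j, inner ℂ (a i) (a j) = inner ℂ (b i) (b j)) (v : ι →₀ ℂ) :
    ‖Finsupp.linearCombination ℂ b v‖ = ‖Finsupp.linearCombination ℂ a v‖ := by
  rw [@norm_eq_sqrt_re_inner ℂ, @norm_eq_sqrt_re_inner ℂ]
  simp only [Finsupp.linearCombination_apply, Finsupp.sum, sum_inner, inner_sum, inner_smul_left,
    inner_smul_right, h]

theorem exists_blocks {K Z : Type*} [NormedAddCommGroup K] [InnerProductSpace ℂ K]
    [NormedAddCommGroup Z] [InnerProductSpace ℂ Z]
    (U : WithLp 2 (K × Z) ≃ₗᵢ[ℂ] WithLp 2 (K × Z)) :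
    ∃ (A : K →L[ℂ] K) (B : Z →L[ℂ] K) (C : K →L[ℂ] Z) (D : Z →L[ℂ] Z), ‖A‖ ≤ 1 ∧
      ∀ x y, U (WithLp.toLp 2 (x, y)) = WithLp.toLp 2 (A x + B y, C x + D y) := by
  let e := WithLp.prodContinuousLinearEquiv 2 ℂ K Z
  let T : K × Z →L[ℂ] K × Z :=
    (e : WithLp 2 (K × Z) →L[ℂ] K × Z) ∘L 
    (U.toContinuousLinearEquiv : WithLp 2 (K × Z) →L[ℂ] WithLp 2 (K × Z)) ∘L (e.symm : K × Z →L[ℂ] WithLp 2 (K × Z))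
  have hT : ∀ x y, U (WithLp.toLp 2 (x, y)) = WithLp.toLp 2 (T (x, y)) := fun x y => rfl
  refine ⟨.fst ℂ K Z ∘L T ∘L .inl ℂ K Z, .fst ℂ K Z ∘L T ∘L .inr ℂ K Z,
    .snd ℂ K Z ∘L T ∘L .inl ℂ K Z, .snd ℂ K Z ∘L T ∘L .inr ℂ K Z, ?_, fun x y => ?_⟩
  · refine ContinuousLinearMap.opNorm_le_bound _ zero_le_one fun x => ?_
    rw [one_mul]
    have h1 : ‖(U (WithLp.toLp 2 (x, 0))).fst‖ ≤ ‖U (WithLp.toLp 2 (x, 0))‖ :=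
      WithLp.norm_fst_le _ _
    rw [U.norm_map, WithLp.norm_toLp_fst] at h1
    exact h1
  · rw [hT]
    have : T (x, y) = T (x, 0) + T (0, y) := by
      rw [← map_add, Prod.mk_add_mk, add_zero, zero_add]
    rw [this]
    rfl

theorem CompletelyContractive.isUnit {φ : (Fin n → ℂ) →ₗ[ℂ] (H →L[ℂ] H)} {K : Type*}
    [NormedAddCommGroup K] [InnerProductSpace ℂ K] [CompleteSpace K]
    {σ : (Fin n → ℂ) →ₗ[ℂ] (K →L[ℂ] K)} (hσ : CompletelyContractive (matrixNorms φ) σ)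
    {A : K →L[ℂ] K} (hA : ‖A‖ ≤ 1) {z : Fin n → ℂ} (hz : z ∈ unitBall φ) :
    IsUnit (1 - σ z ∘L A) := by
  have : ‖σ z * A‖ < 1 := by
    refine (norm_mul_le _ _).trans_lt ?_
    have h1 := hσ.norm_le z
    have h2 : ‖φ z‖ < 1 := hz
    nlinarith [norm_nonneg (σ z), norm_nonneg A]
  exact isUnit_one_sub_of_norm_lt_one this

theorem ringInverse_apply_eq {K : Type*} [NormedAddCommGroup K] [InnerProductSpace ℂ K]
    {T : K →L[ℂ] K} (hT : IsUnit (1 - T)) (x : K) :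
    Ring.inverse (1 - T) x = T (Ring.inverse (1 - T) x) + x := by
  have := congrArg (fun S : K →L[ℂ] K => S x) (Ring.mul_inverse_cancel _ hT)
  simp only [mul_apply_eq_comp, sub_apply, one_apply_eq_self] at this
  exact sub_eq_iff_eq_add'.1 this

theorem ringInverse_comp_eq {K : Type*} [NormedAddCommGroup K] [InnerProductSpace ℂ K]
    {T : K →L[ℂ] K} (hT : IsUnit (1 - T)) (x : K) :
    Ring.inverse (1 - T) x = Ring.inverse (1 - T) (T x) + x := by
  have := congrArg (fun S : K →L[ℂ] K => S x) (Ring.inverse_mul_cancel _ hT)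
  simp only [mul_apply_eq_comp, sub_apply, one_apply_eq_self, map_sub] at this
  exact sub_eq_iff_eq_add'.1 this

variable {K Z : Type*} [NormedAddCommGroup K] [InnerProductSpace ℂ K] [CompleteSpace K]
  [NormedAddCommGroup Z] [InnerProductSpace ℂ Z]

theorem analyticOnNhd_resolvent (σ : (Fin n → ℂ) →ₗ[ℂ] (K →L[ℂ] K)) (A : K →L[ℂ] K)
    (C : K →L[ℂ] Z) {Ω : Set (Fin n → ℂ)} (hΩ : ∀ z ∈ Ω, IsUnit (1 - σ z ∘L A)) :
    AnalyticOnNhd ℂ (fun z => C ∘L Ring.inverse (1 - σ z ∘L A)) Ω := by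
  intro z hz
  have h1 : AnalyticAt ℂ (fun z => (1 : K →L[ℂ] K) - σ z * A) z :=
    analyticAt_const.sub
      (((LinearMap.toContinuousLinearMap σ).analyticAt z).mul analyticAt_const)
  have h2 : AnalyticAt ℂ (Ring.inverse : (K →L[ℂ] K) → _) (1 - σ z * A) := by
    obtain ⟨x, hx⟩ := hΩ z hz
    have : (1 : K →L[ℂ] K) - σ z * A = x := hx.symm
    rw [this]
    exact analyticAt_inverse x
  exact ((ContinuousLinearMap.compL ℂ K K Z C).analyticAt _).comp
    (AnalyticAt.comp (f := fun z => (1 : K →L[ℂ] K) - σ z * A) h2 h1)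

/-- The colligation identity: a unitary realization yields an Agler factorization. -/
theorem factorization_of_realization [CompleteSpace Z] (U : WithLp 2 (K × Z) ≃ₗᵢ[ℂ] WithLp 2 (K × Z))
    {A : K →L[ℂ] K} {B : Z →L[ℂ] K} {C : K →L[ℂ] Z} {D : Z →L[ℂ] Z}
    (hU : ∀ x y, U (WithLp.toLp 2 (x, y)) = WithLp.toLp 2 (A x + B y, C x + D y))
    {s t : K →L[ℂ] K} {P Q : Z →L[ℂ] Z} (hs : IsUnit (1 - s ∘L A)) (ht : IsUnit (1 - t ∘L A))
    (hP : P = D + C ∘L Ring.inverse (1 - s ∘L A) ∘L s ∘L B)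
    (hQ : Q = D + C ∘L Ring.inverse (1 - t ∘L A) ∘L t ∘L B) :
    1 - P ∘L Q.adjoint = (C ∘L Ring.inverse (1 - s ∘L A)) ∘L (1 - s ∘L t.adjoint) ∘L
      (C ∘L Ring.inverse (1 - t ∘L A)).adjoint := by
  -- The colligation carries `(F* x, P* x)` to `(s* F* x, x)`, with `F = C (1 - s A)⁻¹`. Tested
  -- against `(k, y)`, this is the transfer function formula. Inner products of two such vectors
  -- give the factorization.
  have key : ∀ {s : K →L[ℂ] K} {P : Z →L[ℂ] Z}, IsUnit (1 - s ∘L A) →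
      P = D + C ∘L Ring.inverse (1 - s ∘L A) ∘L s ∘L B → ∀ x,
      U (WithLp.toLp 2 ((C ∘L Ring.inverse (1 - s ∘L A)).adjoint x, P.adjoint x)) =
        WithLp.toLp 2 (s.adjoint ((C ∘L Ring.inverse (1 - s ∘L A)).adjoint x), x) := by
    intro s P hs hP x
    rw [← U.eq_symm_apply]
    refine ext_inner_right ℂ fun v => ?_
    conv_rhs => rw [← U.inner_map_map, U.apply_symm_apply]
    obtain ⟨⟨k, y⟩, rfl⟩ := WithLp.toLp_surjective 2 v
    rw [hU]
    simp only [withLp_prod_inner, WithLp.toLp_fst, WithLp.toLp_snd,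
      ContinuousLinearMap.adjoint_inner_left, ← inner_add_right]
    congr 1
    have h1 := ringInverse_comp_eq hs k
    rw [hP]
    simp only [ContinuousLinearMap.comp_apply, add_apply, map_add] at h1 ⊢
    conv_lhs => rw [h1]
    rw [map_add]
    abel
  ext1 y
  refine ext_inner_left ℂ fun x => ?_
  have h := U.inner_map_map (WithLp.toLp 2 ((C ∘L Ring.inverse (1 - s ∘L A)).adjoint x,
    P.adjoint x)) (WithLp.toLp 2 ((C ∘L Ring.inverse (1 - t ∘L A)).adjoint y, Q.adjoint y))
  rw [key hs hP, key ht hQ] at h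
  simp only [withLp_prod_inner, WithLp.toLp_fst, WithLp.toLp_snd] at h
  set F := C ∘L Ring.inverse (1 - s ∘L A)
  set G := C ∘L Ring.inverse (1 - t ∘L A)
  simp only [ContinuousLinearMap.comp_apply, sub_apply, one_apply_eq_self, inner_sub_right,
    map_sub]
  simp only [ContinuousLinearMap.adjoint_inner_left] at h
  linear_combination h

/-- The lurking isometry argument. -/
theorem exists_realization_of_factorization {K : Type u} [NormedAddCommGroup K]
    [InnerProductSpace ℂ K] [CompleteSpace K] {Z : Type} [NormedAddCommGroup Z]
    [InnerProductSpace ℂ Z] [CompleteSpace Z] {φ : (Fin n → ℂ) →ₗ[ℂ] (H →L[ℂ] H)}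
    {σ : (Fin n → ℂ) →ₗ[ℂ] (K →L[ℂ] K)} (hσ : CompletelyContractive (matrixNorms φ) σ)
    {P : (Fin n → ℂ) → Z →L[ℂ] Z} {F : (Fin n → ℂ) → K →L[ℂ] Z}
    (hF : ∀ z ∈ unitBall φ, ∀ w ∈ unitBall φ, 1 - P z ∘L (P w).adjoint =
      F z ∘L (1 - σ z ∘L (σ w).adjoint) ∘L (F w).adjoint) :
    ∃ (L : Type u) (_ : NormedAddCommGroup L) (_ : InnerProductSpace ℂ L) (_ : CompleteSpace L)
      (U : WithLp 2 (L × Z) ≃ₗᵢ[ℂ] WithLp 2 (L × Z)) (A : L →L[ℂ] L) (B : Z →L[ℂ] L)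
      (C : L →L[ℂ] Z) (D : Z →L[ℂ] Z) (τ : (Fin n → ℂ) →ₗ[ℂ] (L →L[ℂ] L)),
      (∀ x y, U (WithLp.toLp 2 (x, y)) = WithLp.toLp 2 (A x + B y, C x + D y)) ∧
      CompletelyContractive (matrixNorms φ) τ ∧
      ∀ z ∈ unitBall φ, IsUnit (1 - τ z ∘L A) ∧
        P z = D + C ∘L Ring.inverse (1 - τ z ∘L A) ∘L τ z ∘L B := by
  -- Equality of the two Gram matrices is the factorization with its negative terms moved across.
  let a : unitBall φ × Z → WithLp 2 (K × Z) := fun q =>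
    WithLp.toLp 2 ((σ q.1).adjoint ((F q.1).adjoint q.2), q.2)
  let b : unitBall φ × Z → WithLp 2 (K × Z) := fun q =>
    WithLp.toLp 2 ((F q.1).adjoint q.2, (P q.1).adjoint q.2)
  have hab : ∀ q q', inner ℂ (a q) (a q') = inner ℂ (b q) (b q') := by
    intro q q'
    have h := congrArg (fun T : Z →L[ℂ] Z => inner ℂ q.2 (T q'.2))
      (hF q.1 q.1.2 q'.1 q'.1.2)
    simp only [ContinuousLinearMap.comp_apply, sub_apply, one_apply_eq_self, inner_sub_right,
      map_sub] at h
    simp only [a, b, withLp_prod_inner, WithLp.toLp_fst, WithLp.toLp_snd,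
      ContinuousLinearMap.adjoint_inner_left]
    linear_combination h
  obtain ⟨U', hU'⟩ := exists_unitary_of_isometric (Finsupp.linearCombination ℂ a)
    (Finsupp.linearCombination ℂ b) (norm_linearCombination_eq hab)
  have hU : ∀ q, U'.symm (WithLp.toLp 2 (WithLp.toLp 2 ((b q).fst, 0), (b q).snd)) =
      WithLp.toLp 2 (WithLp.toLp 2 ((a q).fst, 0), (a q).snd) := by
    intro q
    rw [LinearIsometryEquiv.symm_apply_eq]
    have := hU' (Finsupp.single q 1)
    simp only [Finsupp.linearCombination_single, one_smul] at this
    exact this.symm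
  -- The colligation is the inverse of the dilation, since it has to send `b` to `a`.
  obtain ⟨A, B, C, D, hA, hABCD⟩ := exists_blocks U'.symm
  let L := WithLp 2 (K × WithLp 2 (K × Z))
  let J : K →L[ℂ] L := LinearMap.mkContinuous
    { toFun := fun x => WithLp.toLp 2 (x, 0)
      map_add' := fun x y => withLp_prod_ext rfl (add_zero _).symm
      map_smul' := fun c x => withLp_prod_ext rfl (smul_zero _).symm } 1
    fun x => by rw [one_mul]; exact (WithLp.norm_toLp_fst 2 _ _ x).le
  let Q : L →L[ℂ] K := LinearMap.mkContinuous
    { toFun := fun x => x.fst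
      map_add' := fun x y => rfl
      map_smul' := fun c x => rfl } 1 fun x => by rw [one_mul]; exact WithLp.norm_fst_le _ _
  have hJ : ∀ x, J x = WithLp.toLp 2 (x, 0) := fun x => rfl
  have hQ : ∀ x, Q x = x.fst := fun x => rfl
  have hJQ : ∀ x y, inner ℂ x (J y) = inner ℂ (Q x) y := fun x y => by
    change inner ℂ x.fst y + inner ℂ x.snd (0 : WithLp 2 (K × Z)) = inner ℂ x.fst y
    rw [inner_zero_right, add_zero]
  let τ : (Fin n → ℂ) →ₗ[ℂ] (L →L[ℂ] L) :=
    { toFun := fun z => J ∘L σ z ∘L Q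
      map_add' := fun z w => by ext1 x; simp
      map_smul' := fun c z => by ext1 x; simp }
  have hτ : CompletelyContractive (matrixNorms φ) τ :=
    hσ.conj J Q (LinearMap.mkContinuous_norm_le _ zero_le_one _)
      (LinearMap.mkContinuous_norm_le _ zero_le_one _) fun z x => rfl
  refine ⟨L, inferInstance, inferInstance, inferInstance, U'.symm, A, B, C, D, τ, hABCD, hτ,
    fun z hz => ⟨hτ.isUnit hA hz, ?_⟩⟩
  have hunit := hτ.isUnit hA hz
  ext1 y
  refine ext_inner_left ℂ fun x => ?_
  set u := Ring.inverse (1 - τ z ∘L A) (τ z (B y)) with hu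
  have hu' : u = J (σ z (Q (A u + B y))) := by
    have := ringInverse_apply_eq hunit (τ z (B y))
    rw [← hu] at this
    rw [map_add, map_add, map_add]
    exact this
  -- The state `u` solves `u = τ(z) (A u + B y)`. Unitarity applied to `b` and `(u, y)` gives an
  -- identity whose state components cancel by `h1`; what remains is `⟨x, C u + D y⟩ = ⟨P(z)* x,
  -- y⟩`.
  have h := U'.symm.inner_map_map (WithLp.toLp 2 (WithLp.toLp 2 ((b (⟨z, hz⟩, x)).fst, 0),
    (b (⟨z, hz⟩, x)).snd)) (WithLp.toLp 2 (u, y))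
  rw [hU, hABCD] at h
  have h1 : inner ℂ (WithLp.toLp 2 ((b (⟨z, hz⟩, x)).fst, (0 : WithLp 2 (K × Z)))) u =
      inner ℂ (WithLp.toLp 2 ((a (⟨z, hz⟩, x)).fst, (0 : WithLp 2 (K × Z)))) (A u + B y) := by
    conv_lhs => rw [hu']
    rw [hJQ, hQ, WithLp.toLp_fst, withLp_prod_inner, WithLp.toLp_fst, WithLp.toLp_snd,
      inner_zero_left, add_zero]
    exact (ContinuousLinearMap.adjoint_inner_left _ _ _).symm
  replace h : inner ℂ (WithLp.toLp 2 ((a (⟨z, hz⟩, x)).fst, (0 : WithLp 2 (K × Z)))) (A u + B y) +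
      inner ℂ x (C u + D y) =
      inner ℂ (WithLp.toLp 2 ((b (⟨z, hz⟩, x)).fst, (0 : WithLp 2 (K × Z)))) u +
        inner ℂ ((P z).adjoint x) y := h
  rw [h1, add_right_inj] at h
  have h2 : inner ℂ x (P z y) = inner ℂ x (C u + D y) :=
    (ContinuousLinearMap.adjoint_inner_left _ _ _).symm.trans h.symm
  rw [h2, add_comm]
  rfl

end Realization

/-! ### Contractivity of `∑ σ(e_t) ⊗ S_t` -/

section TensorContraction

open scoped TensorProduct ComplexConjugate

variable {n : ℕ} {H : Type v} [NormedAddCommGroup H] [InnerProductSpace ℂ H]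

/-- The compression of a completely contractive map to a finite-dimensional subspace lies in the
unit ball of the dual operator space. -/
theorem dualNorms_compression_le {R : Type*} [NormedAddCommGroup R] [InnerProductSpace ℂ R]
    {φ : (Fin n → ℂ) →ₗ[ℂ] (H →L[ℂ] H)} {σ : (Fin n → ℂ) →ₗ[ℂ] (R →L[ℂ] R)}
    (hσ : CompletelyContractive (matrixNorms φ) σ) {m : ℕ} {f : Fin m → R}
    (hf : Orthonormal ℂ f) :
    dualNorms (matrixNorms φ) m m
      (fun t => Matrix.of fun a b => inner ℂ (f a) (σ (Pi.single t 1) (f b))) ≤ 1 := by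
  refine Real.sSup_le ?_ zero_le_one
  rintro _ ⟨r, s, B, hB, rfl⟩
  rw [l2_opNorm_le_iff _ zero_le_one]
  intro x
  set X : Fin s → R := fun b' => ∑ b, x (b, b') • f b with hX
  set w : Fin r → R := fun a' => ∑ t, ∑ b', B t a' b' • σ (Pi.single t 1) (X b') with hw
  have hXn : ∀ b', ‖X b'‖ ^ 2 = ∑ b, ‖x (b, b')‖ ^ 2 := by
    intro b'
    have := hf.inner_sum (fun b => x (b, b')) (fun b => x (b, b')) Finset.univ
    rw [← Complex.ofReal_inj, Complex.ofReal_pow, ← @RCLike.ofReal_eq_complex_ofReal,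
      ← inner_self_eq_norm_sq_to_K, this]
    push_cast
    refine Finset.sum_congr rfl fun b _ => ?_
    rw [mul_comm, RCLike.mul_conj]
  have h1 := (norm_tensorSum_le_iff B (fun t => σ (Pi.single t 1)) (matrixNorms_nonneg φ B)).1
    (hσ r s B) X
  have h2 : ∀ a a', ∑ j : Fin m × Fin s, (∑ t, (Matrix.of fun a b =>
      inner ℂ (f a) (σ (Pi.single t 1) (f b))) ⊗ₖ B t) (a, a') j * x j =
      inner ℂ (f a) (w a') := by
    intro a a'
    simp only [hw, hX, inner_sum, inner_smul_right, map_sum, map_smul, Finset.smul_sum,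
      Matrix.sum_apply, Matrix.kroneckerMap_apply, Matrix.of_apply, Finset.sum_mul,
      Fintype.sum_prod_type]
    rw [Finset.sum_comm]
    conv_rhs => rw [Finset.sum_comm]
    refine Finset.sum_congr rfl fun b' _ => ?_
    rw [Finset.sum_comm]
    refine Finset.sum_congr rfl fun t _ => Finset.sum_congr rfl fun b _ => ?_
    ring
  rw [Fintype.sum_prod_type, Fintype.sum_prod_type, Finset.sum_comm]
  calc ∑ a', ∑ a, ‖∑ j : Fin m × Fin s, (∑ t, (Matrix.of fun a b =>
      inner ℂ (f a) (σ (Pi.single t 1) (f b))) ⊗ₖ B t) (a, a') j * x j‖ ^ 2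
      = ∑ a', ∑ a, ‖inner ℂ (f a) (w a')‖ ^ 2 := by simp only [h2]
    _ ≤ ∑ a', ‖w a'‖ ^ 2 := Finset.sum_le_sum fun a' _ => hf.sum_inner_products_le (w a')
    _ ≤ matrixNorms φ r s B ^ 2 * ∑ b', ‖X b'‖ ^ 2 := h1
    _ ≤ 1 ^ 2 * ∑ b', ‖X b'‖ ^ 2 := by
        gcongr
        exact matrixNorms_nonneg φ B
    _ = _ := by
        rw [Finset.sum_comm]
        simp only [hXn]

/-- The slice map `ℓ ⊗ id`. -/
def slice {R M : Type*} [AddCommGroup R] [Module ℂ R] [AddCommGroup M] [Module ℂ M]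
    (l : R →ₗ[ℂ] ℂ) : R ⊗[ℂ] M →ₗ[ℂ] M :=
  TensorProduct.lift (LinearMap.lsmul ℂ M ∘ₗ l)

@[simp]
theorem slice_tmul {R M : Type*} [AddCommGroup R] [Module ℂ R] [AddCommGroup M] [Module ℂ M]
    (l : R →ₗ[ℂ] ℂ) (r : R) (m : M) : slice l (r ⊗ₜ[ℂ] m) = l r • m :=
  rfl

variable {R K : Type*} [NormedAddCommGroup R] [InnerProductSpace ℂ R]
  [NormedAddCommGroup K] [InnerProductSpace ℂ K]

theorem norm_sq_sum_orthonormal_tmul {ι : Type*} [Fintype ι] {f : ι → R} (hf : Orthonormal ℂ f)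
    (y : ι → K) : ‖∑ a, f a ⊗ₜ[ℂ] y a‖ ^ 2 = ∑ a, ‖y a‖ ^ 2 := by
  classical
  rw [← Complex.ofReal_inj, Complex.ofReal_pow, ← @RCLike.ofReal_eq_complex_ofReal,
    ← inner_self_eq_norm_sq_to_K (𝕜 := ℂ)]
  simp only [sum_inner, inner_sum, TensorProduct.inner_tmul, orthonormal_iff_ite.1 hf, ite_mul,
    one_mul, zero_mul, Finset.sum_ite_eq', Finset.mem_univ, if_true]
  push_cast
  refine Finset.sum_congr rfl fun a _ => ?_
  rw [inner_self_eq_norm_sq_to_K]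

/-- Expansion of the first tensor leg in an orthonormal basis, which turns an algebraic tensor into
a finite column of vectors of `K`. -/
theorem eq_sum_tmul_slice {W : Submodule ℂ R} {ι : Type*} [Fintype ι]
    (f : OrthonormalBasis ι ℂ W) {u : R ⊗[ℂ] K}
    (hu : u ∈ LinearMap.range (TensorProduct.map W.subtype (LinearMap.id (R := ℂ) (M := K)))) :
    u = ∑ a, (f a : R) ⊗ₜ[ℂ] slice (innerₛₗ ℂ (f a : R)) u := by
  obtain ⟨u, rfl⟩ := hu
  induction u with
  | zero => simp
  | tmul r y =>
    simp only [TensorProduct.map_tmul, slice_tmul, LinearMap.id_coe, id_eq, Submodule.subtype_apply]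
    conv_lhs => rw [← f.sum_repr' r]
    simp only [Submodule.coe_sum, Submodule.coe_smul, TensorProduct.sum_tmul,
      TensorProduct.smul_tmul]
    rfl
  | add u v hu hv =>
    simp only [map_add, TensorProduct.tmul_add, Finset.sum_add_distrib]
    rw [← hu, ← hv]

/-- If `σ` is completely contractive for `E` and `S` for the dual operator space, then
`∑ t, σ(e_t) ⊗ S_t` is a contraction of the (algebraic) Hilbert space tensor product. -/
theorem norm_sum_map_tmul_le {φ : (Fin n → ℂ) →ₗ[ℂ] (H →L[ℂ] H)}
    {σ : (Fin n → ℂ) →ₗ[ℂ] (R →L[ℂ] R)} (hσ : CompletelyContractive (matrixNorms φ) σ)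
    {S : Fin n → K →L[ℂ] K} (hS : CompletelyContractive (dualNorms (matrixNorms φ)) (tupleMap S))
    (u : R ⊗[ℂ] K) :
    ‖∑ t, TensorProduct.map (σ (Pi.single t 1)).toLinearMap (S t).toLinearMap u‖ ≤ ‖u‖ := by
  set v := ∑ t, TensorProduct.map (σ (Pi.single t 1)).toLinearMap (S t).toLinearMap u with hv
  -- The finite-dimensional `W` has to contain the first legs of both `u` and `v`: then passing from
  -- `u` to `v` involves only the compression of `σ` to `W`, to which the dual norm bound applies.
  obtain ⟨W, W', hW, -, hsub⟩ :=
    TensorProduct.exists_finite_submodule_of_setFinite {u, v} (Set.toFinite _)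
  have hle : ∀ x, x ∈ LinearMap.range (TensorProduct.mapIncl W W') →
      x ∈ LinearMap.range (TensorProduct.map W.subtype (LinearMap.id (R := ℂ) (M := K))) := by
    rintro _ ⟨x, rfl⟩
    refine ⟨TensorProduct.map LinearMap.id W'.subtype x, ?_⟩
    rw [← LinearMap.comp_apply, ← TensorProduct.map_comp]
    rfl
  have hu := eq_sum_tmul_slice (stdOrthonormalBasis ℂ W) (hle u (hsub (by simp)))
  have hv' := eq_sum_tmul_slice (stdOrthonormalBasis ℂ W) (hle v (hsub (by simp)))
  set f := stdOrthonormalBasis ℂ W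
  have hf : Orthonormal ℂ fun a => (f a : R) := f.orthonormal.comp_linearIsometry W.subtypeₗᵢ
  set y := fun a => slice (innerₛₗ ℂ (f a : R)) u with hy
  have hslice : ∀ a, slice (innerₛₗ ℂ (f a : R)) v =
      ∑ t, ∑ b, inner ℂ (f a : R) (σ (Pi.single t 1) (f b)) • S t (y b) := by
    intro a
    rw [hv, map_sum]
    refine Finset.sum_congr rfl fun t _ => ?_
    rw [hu, map_sum, map_sum]
    rfl
  refine le_of_sq_le_sq ?_ (norm_nonneg _)
  rw [hv', hu, norm_sq_sum_orthonormal_tmul hf, norm_sq_sum_orthonormal_tmul hf]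
  have h1 := hS _ _ fun t => Matrix.of fun a b => inner ℂ (f a : R) (σ (Pi.single t 1) (f b : R))
  have h2 := (norm_tensorSum_le_iff _ _ zero_le_one).1
    (h1.trans (dualNorms_compression_le hσ hf)) y
  simp only [Matrix.of_apply, tupleMap, Fintype.linearCombination_apply_single, one_smul, one_pow,
    one_mul] at h2
  simpa only [hslice] using h2

end TensorContraction

/-! ### Polynomials as truncated Neumann series -/

section PolynomialCalculus

open scoped TensorProduct
open Filter Topology
open scoped IsMulCommutative

/-- Letting `t → 0` gives `f(0) = 0`; then one factor `X` is split off and a factor `‖t‖` cancelled,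
which is why only `t ≠ 0` is assumed. -/
theorem Polynomial.X_pow_dvd_of_norm_eval_le (d : ℕ) : ∀ (f : Polynomial ℂ) (c δ : ℝ), 0 < δ →
    (∀ t : ℂ, t ≠ 0 → ‖t‖ < δ → ‖f.eval t‖ ≤ c * ‖t‖ ^ d) → Polynomial.X ^ d ∣ f := by
  induction d with
  | zero => exact fun f _ _ _ _ => by simp
  | succ d ih =>
    intro f c δ hδ h
    have hlim : Tendsto (fun t : ℂ => c * ‖t‖ ^ (d + 1)) (𝓝[≠] 0) (𝓝 (c * ‖(0 : ℂ)‖ ^ (d + 1))) :=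
      (Continuous.tendsto (by fun_prop) 0).mono_left nhdsWithin_le_nhds
    have hlim' : Tendsto (fun t : ℂ => ‖f.eval t‖) (𝓝[≠] 0) (𝓝 ‖f.eval 0‖) :=
      (Continuous.tendsto (by fun_prop) 0).mono_left nhdsWithin_le_nhds
    have hev : ∀ᶠ t : ℂ in 𝓝[≠] 0, ‖f.eval t‖ ≤ c * ‖t‖ ^ (d + 1) := by
      filter_upwards [self_mem_nhdsWithin, mem_nhdsWithin_of_mem_nhds (Metric.ball_mem_nhds 0 hδ)]
        with t ht ht'
      exact h t ht (by simpa using ht')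
    have h0 := le_of_tendsto_of_tendsto hlim' hlim hev
    rw [norm_zero, zero_pow d.succ_ne_zero, mul_zero, norm_le_zero_iff,
      ← Polynomial.coeff_zero_eq_eval_zero] at h0
    obtain ⟨g, rfl⟩ := Polynomial.X_dvd_iff.2 h0
    rw [pow_succ']
    refine mul_dvd_mul_left _ (ih g c δ hδ fun t ht ht' => ?_)
    have := h t ht ht'
    rw [Polynomial.eval_mul, Polynomial.eval_X, norm_mul, pow_succ'] at this
    have hpos : 0 < ‖t‖ := norm_pos_iff.2 ht
    refine le_of_mul_le_mul_left ?_ hpos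
    linarith [mul_left_comm c ‖t‖ (‖t‖ ^ d)]

variable {n : ℕ}

/-- A commuting tuple generates a commutative subalgebra, where polynomial evaluation is available.
-/
theorem exists_algHom_polyOp {K : Type*} [NormedAddCommGroup K] [InnerProductSpace ℂ K]
    {S : Fin n → K →L[ℂ] K} (hS : ∀ i j, Commute (S i) (S j)) :
    ∃ Ψ : MvPolynomial (Fin n) ℂ →ₐ[ℂ] (K →L[ℂ] K), (∀ t, Ψ (MvPolynomial.X t) = S t) ∧
      ∀ q, Ψ q = polyOp q S := by
  have hcomm : ∀ a ∈ Set.range S, ∀ b ∈ Set.range S, a * b = b * a := by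
    rintro _ ⟨i, rfl⟩ _ ⟨j, rfl⟩
    exact hS i j
  have := Algebra.isMulCommutative_adjoin ℂ hcomm
  let s : Fin n → Algebra.adjoin ℂ (Set.range S) := fun t =>
    ⟨S t, Algebra.subset_adjoin ⟨t, rfl⟩⟩
  refine ⟨(Algebra.adjoin ℂ (Set.range S)).val.comp (MvPolynomial.aeval s), fun t => ?_,
    fun q => ?_⟩
  · rw [AlgHom.comp_apply, MvPolynomial.aeval_X]
    rfl
  · rw [AlgHom.comp_apply, MvPolynomial.aeval_def, MvPolynomial.eval₂_eq', map_sum, polyOp]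
    refine Finset.sum_congr rfl fun α _ => ?_
    rw [map_mul, AlgHom.commutes, ← Algebra.smul_def, ← List.prod_ofFn, map_list_prod,
      List.map_ofFn]
    rfl

/-- The states of the linear system `u ↦ T (a u + b)` started at `0`. -/
def systemState {W : Type*} [AddCommGroup W] [Module ℂ W] (T a : W →ₗ[ℂ] W) (b : W) : ℕ → W
  | 0 => 0
  | m + 1 => T (a (systemState T a b m) + b)

/-- Lets one system with polynomial coefficients be specialized both to points `z` and to operator
tuples `S`. -/
theorem map_systemState {W W' : Type*} [AddCommGroup W] [Module ℂ W] [AddCommGroup W']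
    [Module ℂ W'] {T a : W →ₗ[ℂ] W} {T' a' : W' →ₗ[ℂ] W'} (E : W →ₗ[ℂ] W')
    (hT : ∀ w, E (T w) = T' (E w)) (ha : ∀ w, E (a w) = a' (E w)) (b : W) (m : ℕ) :
    E (systemState T a b m) = systemState T' a' (E b) m := by
  induction m with
  | zero => exact map_zero E
  | succ m ih => rw [systemState, systemState, hT, map_add, ha, ih]

theorem systemState_sum {W ι : Type*} [AddCommGroup W] [Module ℂ W] [Fintype ι]
    (T a : W →ₗ[ℂ] W) (b : ι → W) (m : ℕ) :
    systemState T a (∑ k, b k) m = ∑ k, systemState T a (b k) m := by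
  induction m with
  | zero => simp [systemState]
  | succ m ih => simp only [systemState, ih, map_sum, ← Finset.sum_add_distrib]

theorem systemState_smul {W : Type*} [AddCommGroup W] [Module ℂ W] (T a : W →ₗ[ℂ] W) (b : W)
    (c : ℂ) (m : ℕ) : systemState (c • T) a b m =
      ∑ j ∈ Finset.range m, c ^ (j + 1) • ((T ∘ₗ a) ^ j) (T b) := by
  induction m with
  | zero => rfl
  | succ m ih =>
    rw [systemState, ih, Finset.sum_range_succ']
    simp only [map_add, map_sum, map_smul, LinearMap.smul_apply, zero_add, pow_one,
      pow_zero, Module.End.one_apply]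
    congr 1
    refine Finset.sum_congr rfl fun j _ => ?_
    rw [smul_smul, ← pow_succ, pow_succ' (T ∘ₗ a), Module.End.mul_apply, LinearMap.comp_apply]

variable {R : Type*} [NormedAddCommGroup R] [InnerProductSpace ℂ R]

/-- The fixed point and the iteration differ by one application of `T A` per step, and the initial
error is `u` itself. -/
theorem sub_systemState (T A : R →L[ℂ] R) (b u : R) (hu : u = T (A u + b)) (m : ℕ) :
    ‖u - systemState T.toLinearMap A.toLinearMap b m‖ ≤ (‖T‖ * ‖A‖) ^ m * ‖u‖ := by
  induction m with
  | zero => simp [systemState]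
  | succ m ih =>
    have h1 : u - systemState T.toLinearMap A.toLinearMap b (m + 1) =
        T (A (u - systemState T.toLinearMap A.toLinearMap b m)) := by
      conv_lhs => rw [hu]
      rw [systemState, ContinuousLinearMap.coe_coe, ContinuousLinearMap.coe_coe, ← map_sub,
        map_sub A]
      congr 1
      abel
    rw [h1, pow_succ']
    calc _ ≤ ‖T‖ * (‖A‖ * ‖u - systemState T.toLinearMap A.toLinearMap b m‖) :=
          T.le_opNorm_of_le (A.le_opNorm _)
      _ ≤ ‖T‖ * (‖A‖ * ((‖T‖ * ‖A‖) ^ m * ‖u‖)) := by gcongr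
      _ = _ := by ring

theorem MvPolynomial.natDegree_aeval_line_le (q : MvPolynomial (Fin n) ℂ) (z : Fin n → ℂ) :
    (MvPolynomial.aeval (fun j => Polynomial.C (z j) * Polynomial.X) q).natDegree ≤
      q.totalDegree := by
  simpa using MvPolynomial.aeval_natDegree_le q le_rfl
    (fun j => Polynomial.C (z j) * Polynomial.X) fun j =>
      (Polynomial.natDegree_C_mul_le _ _).trans Polynomial.natDegree_X_le

/-- A polynomial represented near the origin by a transfer function is given everywhere by the
truncated Neumann series. -/
theorem eval_eq_systemState {Ω : Set (Fin n → ℂ)} (hΩ : Ω ∈ 𝓝 0)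
    (σ : (Fin n → ℂ) →ₗ[ℂ] (R →L[ℂ] R)) (A : R →L[ℂ] R) (b : R) (l : R →L[ℂ] ℂ) (d : ℂ)
    (q : MvPolynomial (Fin n) ℂ)
    (hq : ∀ z ∈ Ω, ∃ u, u = σ z (A u + b) ∧ MvPolynomial.eval z q = d + l u) {m : ℕ}
    (hm : q.totalDegree ≤ m) (z : Fin n → ℂ) :
    MvPolynomial.eval z q = d + l (systemState (σ z).toLinearMap A.toLinearMap b m) := by
  set v : ℕ → R := fun j => (((σ z).toLinearMap ∘ₗ A.toLinearMap) ^ j) (σ z b) with hv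
  -- The difference of the two sides on the line `t ↦ t z`. It has degree at most `m` and will be
  -- shown to vanish to order `m + 1` at the origin.
  set f : Polynomial ℂ := MvPolynomial.aeval (fun j => Polynomial.C (z j) * Polynomial.X) q -
    (Polynomial.C d + ∑ j ∈ Finset.range m, Polynomial.C (l (v j)) * Polynomial.X ^ (j + 1))
    with hf
  have hfe : ∀ t : ℂ, f.eval t = MvPolynomial.eval (t • z) q -
      (d + l (systemState (σ (t • z)).toLinearMap A.toLinearMap b m)) := by
    intro t
    have h1 : (MvPolynomial.aeval (fun j => Polynomial.C (z j) * Polynomial.X) q).eval t =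
        MvPolynomial.eval (t • z) q := by
      rw [← Polynomial.coe_evalRingHom, MvPolynomial.aeval_def, MvPolynomial.hom_eval₂,
        MvPolynomial.eval, MvPolynomial.coe_eval₂Hom]
      congr 1
      · exact RingHom.ext fun c => Polynomial.eval_C
      · ext j
        change Polynomial.eval t (Polynomial.C (z j) * Polynomial.X) = t * z j
        rw [Polynomial.eval_mul, Polynomial.eval_C, Polynomial.eval_X, mul_comm]
    have h2 : (σ (t • z)).toLinearMap = t • (σ z).toLinearMap := by
      rw [map_smul]; rfl
    rw [hf, Polynomial.eval_sub, h1, h2, systemState_smul, map_sum, Polynomial.eval_add,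
      Polynomial.eval_C, Polynomial.eval_finsetSum]
    congr 2
    refine Finset.sum_congr rfl fun j _ => ?_
    simp only [Polynomial.eval_mul, Polynomial.eval_C, Polynomial.eval_pow, Polynomial.eval_X,
      map_smul, smul_eq_mul, hv]
    exact mul_comm _ _
  have hdeg : f.natDegree ≤ m := by
    refine (Polynomial.natDegree_sub_le_of_le
      ((MvPolynomial.natDegree_aeval_line_le q z).trans hm) ?_).trans (max_self m).le
    refine (Polynomial.natDegree_add_le_of_le (m := 0) (n := m) (Polynomial.natDegree_C d).le
      (Polynomial.natDegree_sum_le_of_forall_le _ _ fun j hj => ?_)).trans (by simp)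
    exact (Polynomial.natDegree_C_mul_X_pow_le _ _).trans (Finset.mem_range.1 hj)
  set s := ‖σ z‖ with hs
  set α := ‖A‖ with hα
  have hs0 : 0 ≤ s := norm_nonneg _
  have hα0 : 0 ≤ α := norm_nonneg _
  obtain ⟨δ, hδ, hball⟩ : ∃ δ > 0, ∀ t : ℂ, ‖t‖ < δ → t • z ∈ Ω := by
    have hc : Tendsto (fun t : ℂ => t • z) (𝓝 0) (𝓝 0) := by
      have : Continuous fun t : ℂ => t • z := by fun_prop
      simpa using this.tendsto 0
    obtain ⟨δ, hδ, h⟩ := Metric.mem_nhds_iff.1 (hc hΩ)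
    exact ⟨δ, hδ, fun t ht => h (by simpa using ht)⟩
  -- The radius makes `‖t‖ s α < 1/2`, whence `‖u‖ ≤ 2 ‖t‖ s ‖b‖`. This bound on `u` supplies one
  -- more power of `t` than the `m` from the truncation error.
  have hdvd : Polynomial.X ^ (m + 1) ∣ f := by
    refine Polynomial.X_pow_dvd_of_norm_eval_le (m + 1) f (‖l‖ * ((s * α) ^ m * (2 * s * ‖b‖)))
      (min δ (1 / (2 * (s * α + 1)))) (by positivity) fun t _ ht => ?_
    obtain ⟨u, hu, hqu⟩ := hq _ (hball t (ht.trans_le (min_le_left _ _)))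
    have ht2 := ht.trans_le (min_le_right _ _)
    rw [lt_div_iff₀ (by positivity)] at ht2
    have hσ : ‖σ (t • z)‖ = ‖t‖ * s := by rw [map_smul, norm_smul]
    have hun : ‖u‖ ≤ 2 * (‖t‖ * s * ‖b‖) := by
      have h1 : ‖u‖ ≤ ‖t‖ * s * (α * ‖u‖ + ‖b‖) := by
        conv_lhs => rw [hu]
        rw [← hσ]
        exact (σ (t • z)).le_opNorm_of_le
          ((norm_add_le _ _).trans (add_le_add_left (A.le_opNorm u) _))
      nlinarith [norm_nonneg t, norm_nonneg u, mul_nonneg (norm_nonneg t) (norm_nonneg u)]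
    rw [hfe, hqu, add_sub_add_left_eq_sub, ← map_sub]
    calc _ ≤ ‖l‖ * ((‖t‖ * s * α) ^ m * (2 * (‖t‖ * s * ‖b‖))) := by
          refine l.le_opNorm_of_le ((sub_systemState _ A b u hu m).trans ?_)
          rw [hσ]
          gcongr
      _ = _ := by ring
  have hf0 : f = 0 := by
    refine Polynomial.eq_zero_of_dvd_of_natDegree_lt hdvd ?_
    rw [Polynomial.natDegree_X_pow]
    omega
  have := hfe 1
  rw [hf0, Polynomial.eval_zero, one_smul] at this
  exact (sub_eq_zero.1 this.symm)

end PolynomialCalculus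

/-! ### From realization to the von Neumann inequality -/

section VonNeumann

open scoped TensorProduct
open Filter Topology

variable {n N : ℕ} {R K : Type*} [NormedAddCommGroup R] [InnerProductSpace ℂ R]
  [NormedAddCommGroup K] [InnerProductSpace ℂ K]

theorem slice_map {R R' M M' : Type*} [AddCommGroup R] [Module ℂ R] [AddCommGroup R'] [Module ℂ R']
    [AddCommGroup M] [Module ℂ M] [AddCommGroup M'] [Module ℂ M'] (l : R' →ₗ[ℂ] ℂ) (f : R →ₗ[ℂ] R')
    (g : M →ₗ[ℂ] M') (u : R ⊗[ℂ] M) : slice l (TensorProduct.map f g u) = g (slice (l ∘ₗ f) u) := by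
  induction u with
  | zero => simp
  | add u₁ u₂ h₁ h₂ => simp only [map_add, h₁, h₂]
  | tmul r m => exact (map_smul g _ _).symm

/-- The functional `x ↦ (x₂)_i` on `R ⊕ ℂ^N`. -/
def sndCoord (R : Type*) [NormedAddCommGroup R] [InnerProductSpace ℂ R] (i : Fin N) :
    WithLp 2 (R × EuclideanSpace ℂ (Fin N)) →ₗ[ℂ] ℂ where
  toFun x := x.snd i
  map_add' _ _ := rfl
  map_smul' _ _ := rfl

/-- The projection `R ⊕ ℂ^N → R`. -/
def fstMap (R : Type*) [NormedAddCommGroup R] [InnerProductSpace ℂ R] (N : ℕ) :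
    WithLp 2 (R × EuclideanSpace ℂ (Fin N)) →ₗ[ℂ] R where
  toFun x := x.fst
  map_add' _ _ := rfl
  map_smul' _ _ := rfl

theorem inner_prod_tensor (w w' : WithLp 2 (R × EuclideanSpace ℂ (Fin N)) ⊗[ℂ] K) :
    inner ℂ w w' = inner ℂ (TensorProduct.map (fstMap R N) LinearMap.id w)
      (TensorProduct.map (fstMap R N) LinearMap.id w') +
      ∑ i, inner ℂ (slice (sndCoord R i) w) (slice (sndCoord R i) w') := by
  induction w with
  | zero => simp
  | add w₁ w₂ h₁ h₂ =>
    simp only [inner_add_left, map_add, h₁, h₂, Finset.sum_add_distrib]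
    ring
  | tmul r y =>
    induction w' with
    | zero => simp
    | add w₁ w₂ h₁ h₂ =>
      simp only [inner_add_right, map_add, h₁, h₂, Finset.sum_add_distrib]
      ring
    | tmul r' y' =>
      simp only [TensorProduct.inner_tmul, TensorProduct.map_tmul, slice_tmul, withLp_prod_inner,
        inner_smul_left, inner_smul_right, PiLp.inner_apply, LinearMap.id_coe, id_eq]
      rw [add_mul, Finset.sum_mul]
      congr 1
      refine Finset.sum_congr rfl fun i _ => ?_
      change r'.snd i * starRingEnd ℂ (r.snd i) * _ =
        r'.snd i * (starRingEnd ℂ (r.snd i) * _)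
      ring

theorem norm_sq_prod_tensor (w : WithLp 2 (R × EuclideanSpace ℂ (Fin N)) ⊗[ℂ] K) :
    ‖w‖ ^ 2 = ‖TensorProduct.map (fstMap R N) LinearMap.id w‖ ^ 2 +
      ∑ i, ‖slice (sndCoord R i) w‖ ^ 2 := by
  rw [← Complex.ofReal_inj]
  push_cast
  simp only [← @RCLike.ofReal_eq_complex_ofReal, ← inner_self_eq_norm_sq_to_K (𝕜 := ℂ)]
  exact inner_prod_tensor w w

/-- Amplification of a unitary colligation by a Hilbert space `K`. -/
theorem norm_sq_colligation
    (U : WithLp 2 (R × EuclideanSpace ℂ (Fin N)) ≃ₗᵢ[ℂ] WithLp 2 (R × EuclideanSpace ℂ (Fin N)))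
    {A : R →L[ℂ] R} {B : EuclideanSpace ℂ (Fin N) →L[ℂ] R}
    {C : R →L[ℂ] EuclideanSpace ℂ (Fin N)}
    {D : EuclideanSpace ℂ (Fin N) →L[ℂ] EuclideanSpace ℂ (Fin N)}
    (hU : ∀ x y, U (WithLp.toLp 2 (x, y)) = WithLp.toLp 2 (A x + B y, C x + D y))
    (u : R ⊗[ℂ] K) (x : Fin N → K) :
    ‖TensorProduct.map A.toLinearMap LinearMap.id u +
        ∑ k, B (EuclideanSpace.single k 1) ⊗ₜ[ℂ] x k‖ ^ 2 +
      ∑ i, ‖slice ((EuclideanSpace.proj i : _ →L[ℂ] ℂ) ∘L C).toLinearMap u +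
        ∑ k, D (EuclideanSpace.single k 1) i • x k‖ ^ 2 = ‖u‖ ^ 2 + ∑ k, ‖x k‖ ^ 2 := by
  let J : R →ₗ[ℂ] WithLp 2 (R × EuclideanSpace ℂ (Fin N)) :=
    { toFun := fun r => WithLp.toLp 2 (r, 0)
      map_add' := fun x y => withLp_prod_ext rfl (add_zero _).symm
      map_smul' := fun c x => withLp_prod_ext rfl (smul_zero _).symm }
  set w : WithLp 2 (R × EuclideanSpace ℂ (Fin N)) ⊗[ℂ] K := TensorProduct.map J LinearMap.id u +
    ∑ k, WithLp.toLp 2 (0, EuclideanSpace.single k 1) ⊗ₜ[ℂ] x k with hw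
  have hnorm : ‖TensorProduct.map U.toLinearIsometry.toLinearMap LinearMap.id w‖ = ‖w‖ :=
    (U.toLinearIsometry.rTensor K).norm_map w
  have h := congrArg (fun r : ℝ => r ^ 2) hnorm
  simp only [norm_sq_prod_tensor] at h
  have e1 : TensorProduct.map (fstMap R N) LinearMap.id
      (TensorProduct.map U.toLinearIsometry.toLinearMap LinearMap.id w) =
      TensorProduct.map A.toLinearMap LinearMap.id u +
        ∑ k, B (EuclideanSpace.single k 1) ⊗ₜ[ℂ] x k := by
    rw [hw, map_add, map_add, map_sum, map_sum]
    congr 1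
    · rw [← LinearMap.comp_apply, ← LinearMap.comp_apply, ← TensorProduct.map_comp,
        ← TensorProduct.map_comp]
      congr 2
      ext r
      change (U (WithLp.toLp 2 (r, 0))).fst = A r
      simp only [hU, map_zero, add_zero, WithLp.toLp_fst]
    · refine Finset.sum_congr rfl fun k _ => ?_
      change (U (WithLp.toLp 2 (0, _))).fst ⊗ₜ[ℂ] x k = _
      simp only [hU, map_zero, zero_add, WithLp.toLp_fst]
  have e2 : ∀ i, slice (sndCoord R i)
      (TensorProduct.map U.toLinearIsometry.toLinearMap LinearMap.id w) =
      slice ((EuclideanSpace.proj i : _ →L[ℂ] ℂ) ∘L C).toLinearMap u +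
        ∑ k, D (EuclideanSpace.single k 1) i • x k := by
    intro i
    rw [hw, map_add, map_add, map_sum, map_sum]
    congr 1
    · rw [slice_map, slice_map, LinearMap.id_apply, LinearMap.id_apply]
      congr 2
      ext r
      change (U (WithLp.toLp 2 (r, 0))).snd i = C r i
      simp only [hU, map_zero, add_zero, WithLp.toLp_snd]
    · refine Finset.sum_congr rfl fun k _ => ?_
      change (U (WithLp.toLp 2 (0, _))).snd i • x k = _
      simp only [hU, map_zero, zero_add, WithLp.toLp_snd]
  have e3 : TensorProduct.map (fstMap R N) LinearMap.id w = u := by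
    rw [hw, map_add, map_sum]
    have h1 : ∑ k, TensorProduct.map (fstMap R N) (LinearMap.id (R := ℂ) (M := K))
        (WithLp.toLp 2 ((0 : R), EuclideanSpace.single k (1 : ℂ)) ⊗ₜ[ℂ] x k) = 0 :=
      Finset.sum_eq_zero fun k _ => TensorProduct.zero_tmul _ _
    rw [h1, add_zero, ← LinearMap.comp_apply, ← TensorProduct.map_comp]
    exact LinearMap.congr_fun TensorProduct.map_id u
  have e4 : ∀ i, slice (sndCoord R i) w = x i := by
    intro i
    rw [hw, map_add, map_sum]
    have h1 : slice (sndCoord R i) (TensorProduct.map J LinearMap.id u) = 0 := by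
      have h2 : sndCoord R i ∘ₗ J = 0 := rfl
      have h3 : slice (0 : R →ₗ[ℂ] ℂ) = (0 : R ⊗[ℂ] K →ₗ[ℂ] K) :=
        TensorProduct.ext' fun r m => zero_smul ℂ m
      rw [slice_map, h2, h3, LinearMap.zero_apply, map_zero]
    rw [h1, zero_add, Finset.sum_eq_single i]
    · change (EuclideanSpace.single i (1 : ℂ) : EuclideanSpace ℂ (Fin N)) i • x i = x i
      simp
    · intro k _ hk
      change (EuclideanSpace.single k (1 : ℂ) : EuclideanSpace ℂ (Fin N)) i • x k = 0
      simp [hk.symm]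
    · simp
  simpa only [e1, e2, e3, e4] using h

theorem matPolyEval_single (p : Matrix (Fin N) (Fin N) (MvPolynomial (Fin n) ℂ)) (z : Fin n → ℂ)
    (i k : Fin N) :
    matPolyEval p z (EuclideanSpace.single k 1) i = MvPolynomial.eval z (p i k) := by
  simp [matPolyEval, Matrix.ofLp_toEuclideanCLM]

theorem unitBall_mem_nhds {H : Type v} [NormedAddCommGroup H] [InnerProductSpace ℂ H]
    (φ : (Fin n → ℂ) →ₗ[ℂ] (H →L[ℂ] H)) : unitBall φ ∈ 𝓝 0 := by
  have hc : Continuous fun z => ‖φ z‖ := (LinearMap.continuous_of_finiteDimensional φ).norm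
  exact (isOpen_lt hc continuous_const).mem_nhds (by simp)

/-- The von Neumann inequality for polynomials with a unitary realization. -/
theorem norm_matPolyOp_le_of_realization {H : Type v} [NormedAddCommGroup H]
    [InnerProductSpace ℂ H] {φ : (Fin n → ℂ) →ₗ[ℂ] (H →L[ℂ] H)}
    (p : Matrix (Fin N) (Fin N) (MvPolynomial (Fin n) ℂ))
    (U : WithLp 2 (R × EuclideanSpace ℂ (Fin N)) ≃ₗᵢ[ℂ] WithLp 2 (R × EuclideanSpace ℂ (Fin N)))
    {A : R →L[ℂ] R} {B : EuclideanSpace ℂ (Fin N) →L[ℂ] R}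
    {C : R →L[ℂ] EuclideanSpace ℂ (Fin N)}
    {D : EuclideanSpace ℂ (Fin N) →L[ℂ] EuclideanSpace ℂ (Fin N)}
    {σ : (Fin n → ℂ) →ₗ[ℂ] (R →L[ℂ] R)}
    (hU : ∀ x y, U (WithLp.toLp 2 (x, y)) = WithLp.toLp 2 (A x + B y, C x + D y))
    (hσ : CompletelyContractive (matrixNorms φ) σ)
    (hp : ∀ z ∈ unitBall φ, IsUnit (1 - σ z ∘L A) ∧
      matPolyEval p z = D + C ∘L Ring.inverse (1 - σ z ∘L A) ∘L σ z ∘L B)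
    {S : Fin n → K →L[ℂ] K} (hS : ∀ i j, Commute (S i) (S j))
    (hSc : CompletelyContractive (dualNorms (matrixNorms φ)) (tupleMap S)) :
    ‖matPolyOp p S‖ ≤ 1 := by
  set e : Fin N → EuclideanSpace ℂ (Fin N) := fun k => EuclideanSpace.single k 1 with he
  set C' : Fin N → R →L[ℂ] ℂ := fun i => (EuclideanSpace.proj i : _ →L[ℂ] ℂ) ∘L C with hC'
  obtain ⟨M, hM⟩ : ∃ M, ∀ i k, (p i k).totalDegree ≤ M :=
    ⟨Finset.univ.sup fun q : Fin N × Fin N => (p q.1 q.2).totalDegree, fun i k =>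
      Finset.le_sup (f := fun q : Fin N × Fin N => (p q.1 q.2).totalDegree)
        (Finset.mem_univ (i, k))⟩
  have hq : ∀ i k, ∀ z ∈ unitBall φ, ∃ u, u = σ z (A u + B (e k)) ∧
      MvPolynomial.eval z (p i k) = D (e k) i + C' i u := by
    intro i k z hz
    obtain ⟨h1, h2⟩ := hp z hz
    refine ⟨Ring.inverse (1 - σ z ∘L A) (σ z (B (e k))), ?_, ?_⟩
    · rw [map_add]
      exact ringInverse_apply_eq h1 _
    · rw [← matPolyEval_single, h2]
      rfl
  -- The universal system, in which multiplication by the variable `X t` takes the place of `z t` or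
  -- `S t`.
  set TX : R ⊗[ℂ] MvPolynomial (Fin n) ℂ →ₗ[ℂ] R ⊗[ℂ] MvPolynomial (Fin n) ℂ :=
    ∑ t, TensorProduct.map (σ (Pi.single t 1)).toLinearMap
      (LinearMap.mulLeft ℂ (MvPolynomial.X t)) with hTX
  set AX : R ⊗[ℂ] MvPolynomial (Fin n) ℂ →ₗ[ℂ] R ⊗[ℂ] MvPolynomial (Fin n) ℂ :=
    TensorProduct.map A.toLinearMap LinearMap.id with hAX
  have hpoly : ∀ m, M ≤ m → ∀ i k, p i k = MvPolynomial.C (D (e k) i) +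
      slice (C' i).toLinearMap (systemState TX AX (B (e k) ⊗ₜ 1) m) := by
    intro m hm i k
    refine MvPolynomial.funext fun z => ?_
    rw [eval_eq_systemState (unitBall_mem_nhds φ) σ A (B (e k)) (C' i) (D (e k) i) (p i k)
      (hq i k) ((hM i k).trans hm) z, map_add, MvPolynomial.eval_C]
    congr 1
    let ev : MvPolynomial (Fin n) ℂ →ₗ[ℂ] ℂ := (MvPolynomial.aeval z).toLinearMap
    have hev : ∀ q, ev q = MvPolynomial.eval z q := fun q => by
      rw [← MvPolynomial.coe_aeval_eq_eval]; rfl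
    let E : R ⊗[ℂ] MvPolynomial (Fin n) ℂ →ₗ[ℂ] R :=
      (TensorProduct.rid ℂ R).toLinearMap ∘ₗ TensorProduct.map LinearMap.id ev
    have hE : ∀ r q, E (r ⊗ₜ q) = MvPolynomial.eval z q • r := fun r q => by
      rw [← hev]; rfl
    have h1 := map_systemState (T := TX) (T' := (σ z).toLinearMap) (a := AX)
      (a' := A.toLinearMap) E (fun w => by
        induction w with
        | zero => simp
        | add u₁ u₂ h₁ h₂ => simp only [map_add, h₁, h₂]
        | tmul r q =>
          rw [hTX, LinearMap.sum_apply, map_sum, hE, map_eq_sum_single σ z]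
          simp only [TensorProduct.map_tmul, hE, LinearMap.mulLeft_apply, map_mul,
            MvPolynomial.eval_X, map_smul, ContinuousLinearMap.coe_coe, sum_apply, smul_apply,
            Finset.smul_sum, smul_smul]
          exact Finset.sum_congr rfl fun t _ => by rw [mul_comm])
      (fun w => by
        induction w with
        | zero => simp
        | add u₁ u₂ h₁ h₂ => simp only [map_add, h₁, h₂]
        | tmul r q => simp only [hAX, TensorProduct.map_tmul, hE, LinearMap.id_coe, id_eq, map_smul])
      (B (e k) ⊗ₜ 1) m
    rw [hE, map_one, one_smul] at h1
    rw [← h1]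
    generalize systemState TX AX (B (e k) ⊗ₜ 1) m = w
    induction w with
    | zero => simp
    | add u₁ u₂ h₁ h₂ => simp only [map_add, h₁, h₂]
    | tmul r q =>
      rw [hE, slice_tmul, map_smul, MvPolynomial.smul_eval, smul_eq_mul, mul_comm]
      rfl
  obtain ⟨Ψ, hΨX, hΨ⟩ := exists_algHom_polyOp hS
  set TS : R ⊗[ℂ] K →ₗ[ℂ] R ⊗[ℂ] K :=
    ∑ t, TensorProduct.map (σ (Pi.single t 1)).toLinearMap (S t).toLinearMap with hTS
  set AS : R ⊗[ℂ] K →ₗ[ℂ] R ⊗[ℂ] K := TensorProduct.map A.toLinearMap LinearMap.id with hAS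
  refine ContinuousLinearMap.opNorm_le_bound _ zero_le_one fun x => ?_
  rw [one_mul]
  set b : R ⊗[ℂ] K := ∑ k, B (e k) ⊗ₜ[ℂ] x k with hb
  -- Past the degree the output no longer depends on `m`, although the states may keep changing.
  have hout : ∀ m, M ≤ m → ∀ i, matPolyOp p S x i =
      slice (C' i).toLinearMap (systemState TS AS b m) + ∑ k, D (e k) i • x k := by
    intro m hm i
    rw [matPolyOp, opMatrix_apply, hb, systemState_sum, map_sum, ← Finset.sum_add_distrib]
    refine Finset.sum_congr rfl fun k _ => ?_
    rw [Matrix.map_apply, ← hΨ, hpoly m hm i k, add_comm, map_add, add_apply]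
    let ev : MvPolynomial (Fin n) ℂ →ₗ[ℂ] K :=
      { toFun := fun q => Ψ q (x k)
        map_add' := fun q q' => by rw [map_add, add_apply]
        map_smul' := fun c q => by rw [map_smul, smul_apply, RingHom.id_apply] }
    have hev : ∀ q, ev q = Ψ q (x k) := fun q => rfl
    have h1 := map_systemState (T := TX) (T' := TS) (a := AX) (a' := AS)
      (TensorProduct.map LinearMap.id ev) (fun w => by
        induction w with
        | zero => simp
        | add u₁ u₂ h₁ h₂ => simp only [map_add, h₁, h₂]
        | tmul r q =>
          simp only [hTX, hTS, LinearMap.sum_apply, map_sum, TensorProduct.map_tmul,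
            LinearMap.id_coe, id_eq, LinearMap.mulLeft_apply, hev, map_mul, hΨX]
          rfl)
      (fun w => by
        induction w with
        | zero => simp
        | add u₁ u₂ h₁ h₂ => simp only [map_add, h₁, h₂]
        | tmul r q => rfl)
      (B (e k) ⊗ₜ 1) m
    rw [TensorProduct.map_tmul, hev, map_one, LinearMap.id_apply, one_apply_eq_self] at h1
    rw [← h1]
    congr 1
    · rw [slice_map]
      rfl
    · rw [← MvPolynomial.algebraMap_eq, AlgHom.commutes, ContinuousLinearMap.algebraMap_apply]
  by_contra! hlt
  set y := matPolyOp p S x with hy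
  set s : ℕ → ℝ := fun m => ‖systemState TS AS b m‖ ^ 2 with hs
  -- Energy balance: the amplified colligation preserves the total squared norm, and the passage to
  -- the next state is a contraction.
  have hstep : ∀ m, M ≤ m → s (m + 1) ≤ s m - (‖y‖ ^ 2 - ‖x‖ ^ 2) := by
    intro m hm
    have h1 := norm_sq_colligation U hU (systemState TS AS b m) x
    have h2 : ‖systemState TS AS b (m + 1)‖ ≤ ‖AS (systemState TS AS b m) + b‖ := by
      rw [systemState, hTS, LinearMap.sum_apply]
      exact norm_sum_map_tmul_le hσ hSc _
    have h3 := pow_le_pow_left₀ (norm_nonneg _) h2 2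
    have h4 : ‖y‖ ^ 2 = ∑ i, ‖slice (C' i).toLinearMap (systemState TS AS b m) +
        ∑ k, D (e k) i • x k‖ ^ 2 := by
      rw [PiLp.norm_sq_eq_of_L2]
      exact Finset.sum_congr rfl fun i _ => by rw [hy, hout m hm i]
    have h5 : ‖x‖ ^ 2 = ∑ k, ‖x k‖ ^ 2 := PiLp.norm_sq_eq_of_L2 _ _
    rw [← h4, ← h5] at h1
    simp only [hs]
    linarith
  have hpos : 0 < ‖y‖ ^ 2 - ‖x‖ ^ 2 := by
    have := pow_lt_pow_left₀ hlt (norm_nonneg _) two_ne_zero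
    linarith
  have hiter : ∀ j : ℕ, s (M + j) ≤ s M - j * (‖y‖ ^ 2 - ‖x‖ ^ 2) := by
    intro j
    induction j with
    | zero => simp
    | succ j ih =>
      have := hstep (M + j) (Nat.le_add_right _ _)
      rw [← add_assoc]
      push_cast
      linarith
  obtain ⟨j, hj⟩ := exists_nat_gt (s M / (‖y‖ ^ 2 - ‖x‖ ^ 2))
  rw [div_lt_iff₀ hpos] at hj
  have h0 : 0 ≤ s (M + j) := sq_nonneg _
  linarith [hiter j]

end VonNeumann

/-! ### The Agler cone and its closedness -/

section AglerCone

open scoped ComplexConjugate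
open Filter Topology

variable {n : ℕ} {X : Type u} {H : Type v} [NormedAddCommGroup H] [InnerProductSpace ℂ H]

/-- The sesquilinear form with matrix `G` on finitely supported vectors. -/
def gramForm {Y : Type*} (G : Y → Y → ℂ) (c d : Y →₀ ℂ) : ℂ :=
  ∑ y ∈ c.support, ∑ y' ∈ d.support, conj (c y) * d y' * G y y'

theorem gramForm_eq_sum {Y : Type*} (G : Y → Y → ℂ) (c d : Y →₀ ℂ) :
    gramForm G c d = c.sum fun y a => d.sum fun y' b => conj a * b * G y y' :=
  rfl

theorem gramForm_add_left {Y : Type*} (G : Y → Y → ℂ) (c c' d : Y →₀ ℂ) :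
    gramForm G (c + c') d = gramForm G c d + gramForm G c' d := by
  simp only [gramForm_eq_sum]
  refine Finsupp.sum_add_index' (fun y => by simp) fun y a b => ?_
  simp only [Finsupp.sum, ← Finset.sum_add_distrib, map_add, add_mul]

theorem gramForm_smul_left {Y : Type*} (G : Y → Y → ℂ) (r : ℂ) (c d : Y →₀ ℂ) :
    gramForm G (r • c) d = conj r * gramForm G c d := by
  simp only [gramForm_eq_sum]
  rw [Finsupp.sum_smul_index' fun y => by simp]
  simp only [Finsupp.sum, Finset.mul_sum, smul_eq_mul, map_mul, mul_assoc]

theorem gramForm_conj {Y : Type*} {G : Y → Y → ℂ} (hG : ∀ y y', conj (G y' y) = G y y')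
    (c d : Y →₀ ℂ) : conj (gramForm G d c) = gramForm G c d := by
  simp only [gramForm, map_sum, map_mul, RCLike.conj_conj, hG]
  rw [Finset.sum_comm]
  refine Finset.sum_congr rfl fun y _ => Finset.sum_congr rfl fun y' _ => ?_
  ring

theorem gramForm_inner {Y K : Type*} [NormedAddCommGroup K] [InnerProductSpace ℂ K] (v : Y → K)
    (c d : Y →₀ ℂ) : gramForm (fun y y' => inner ℂ (v y) (v y')) c d =
      inner ℂ (Finsupp.linearCombination ℂ v c) (Finsupp.linearCombination ℂ v d) := by
  simp only [gramForm, Finsupp.linearCombination_apply, Finsupp.sum, sum_inner, inner_sum,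
    inner_smul_left, inner_smul_right, Finset.mul_sum]
  rw [Finset.sum_comm]
  refine Finset.sum_congr rfl fun y _ => Finset.sum_congr rfl fun y' _ => ?_
  ring

theorem continuous_gramForm {Y : Type*} (c d : Y →₀ ℂ) :
    Continuous fun G : Y → Y → ℂ => gramForm G c d := by
  unfold gramForm
  fun_prop

theorem gramForm_add {Y : Type*} (G G' : Y → Y → ℂ) (c d : Y →₀ ℂ) :
    gramForm (G + G') c d = gramForm G c d + gramForm G' c d := by
  simp only [gramForm, Pi.add_apply, mul_add, Finset.sum_add_distrib]

theorem gramForm_smul {Y : Type*} (r : ℝ) (G : Y → Y → ℂ) (c d : Y →₀ ℂ) :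
    gramForm (r • G) c d = r • gramForm G c d := by
  simp only [gramForm, Pi.smul_apply, Finset.smul_sum, mul_smul_comm]

/-- The copy of a finitely supported vector in the block `o`. -/
def block (o : Option (Fin n)) (c : X →₀ ℂ) : Option (Fin n) × X →₀ ℂ :=
  c.mapDomain fun x => (o, x)

/-- The row `∑ t, ∑ a, conj (A_t)_{a b} c_a` of the adjoint of a matrix acting on a column of
vectors. -/
def adjointRow {k l : ℕ} (A : Fin n → Matrix (Fin k) (Fin l) ℂ) (c : Fin k → X →₀ ℂ) (b : Fin l) :
    Option (Fin n) × X →₀ ℂ :=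
  ∑ t, ∑ a, conj (A t a b) • block (some t) (c a)

/-- Gram matrices of families `f_x, g_{t,x}` for which `f_x ↦ g_{t,x}` defines the adjoint of a
completely contractive map. -/
structure IsAglerGram (μ : MatrixNorms n)
    (G : Option (Fin n) × X → Option (Fin n) × X → ℂ) : Prop where
  herm : ∀ y y', conj (G y' y) = G y y'
  nonneg : ∀ c, 0 ≤ (gramForm G c c).re
  contractive : ∀ (k l : ℕ) (A : Fin n → Matrix (Fin k) (Fin l) ℂ) (c : Fin k → X →₀ ℂ),
    ∑ b, (gramForm G (adjointRow A c b) (adjointRow A c b)).re ≤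
      μ k l A ^ 2 * ∑ a, (gramForm G (block none (c a)) (block none (c a))).re

theorem IsAglerGram.add {μ : MatrixNorms n} {G G' : Option (Fin n) × X → Option (Fin n) × X → ℂ}
    (hG : IsAglerGram μ G) (hG' : IsAglerGram μ G') : IsAglerGram μ (G + G') where
  herm y y' := by simp only [Pi.add_apply, map_add, hG.herm, hG'.herm]
  nonneg c := by
    rw [gramForm_add, Complex.add_re]
    exact add_nonneg (hG.nonneg c) (hG'.nonneg c)
  contractive k l A c := by
    simp only [gramForm_add, Complex.add_re, Finset.sum_add_distrib, mul_add]
    exact add_le_add (hG.contractive k l A c) (hG'.contractive k l A c)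

theorem IsAglerGram.smul {μ : MatrixNorms n} {G : Option (Fin n) × X → Option (Fin n) × X → ℂ}
    (hG : IsAglerGram μ G) {r : ℝ} (hr : 0 ≤ r) : IsAglerGram μ (r • G) where
  herm y y' := by simp [hG.herm]
  nonneg c := by
    rw [gramForm_smul, Complex.smul_re]
    exact smul_nonneg hr (hG.nonneg c)
  contractive k l A c := by
    simp only [gramForm_smul, Complex.smul_re, smul_eq_mul, ← Finset.mul_sum]
    rw [mul_left_comm]
    exact mul_le_mul_of_nonneg_left (hG.contractive k l A c) hr

/-- Each condition is closed and involves finitely many entries of `G`. This is the advantage of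
Gram matrices over families of vectors in varying Hilbert spaces. -/
theorem isClosed_isAglerGram (μ : MatrixNorms n) :
    IsClosed {G : Option (Fin n) × X → Option (Fin n) × X → ℂ | IsAglerGram μ G} := by
  have h : {G : Option (Fin n) × X → Option (Fin n) × X → ℂ | IsAglerGram μ G} =
      (⋂ y, ⋂ y', {G | conj (G y' y) = G y y'}) ∩ ((⋂ c, {G | 0 ≤ (gramForm G c c).re}) ∩
      ⋂ k, ⋂ l, ⋂ A : Fin n → Matrix (Fin k) (Fin l) ℂ, ⋂ c : Fin k → X →₀ ℂ,
        {G | ∑ b, (gramForm G (adjointRow A c b) (adjointRow A c b)).re ≤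
          μ k l A ^ 2 * ∑ a, (gramForm G (block none (c a)) (block none (c a))).re}) := by
    ext G
    simp only [Set.mem_inter_iff, Set.mem_iInter]
    exact ⟨fun h => ⟨h.1, h.2, h.3⟩, fun h => ⟨h.1, h.2.1, h.2.2⟩⟩
  have hc : ∀ c d : Option (Fin n) × X →₀ ℂ, Continuous
      fun G : Option (Fin n) × X → Option (Fin n) × X → ℂ => (gramForm G c d).re :=
    fun c d => Complex.continuous_re.comp (continuous_gramForm c d)
  rw [h]
  refine (isClosed_iInter fun y => isClosed_iInter fun y' => isClosed_eq
    (Complex.continuous_conj.comp (by fun_prop)) (by fun_prop)).inter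
    ((isClosed_iInter fun c => isClosed_le continuous_const (hc c c)).inter
    (isClosed_iInter fun k => isClosed_iInter fun l => isClosed_iInter fun A =>
      isClosed_iInter fun c => isClosed_le ?_ ?_))
  · exact continuous_finsetSum _ fun b _ => hc _ _
  · exact continuous_const.mul (continuous_finsetSum _ fun b _ => hc _ _)

/-- The kernel `⟨f_x, f_x'⟩ - ⟨∑ t, conj (x_t) g_{t,x}, ∑ t, conj (x'_t) g_{t,x'}⟩`. -/
def aglerKernel (pt : X → Fin n → ℂ) (G : Option (Fin n) × X → Option (Fin n) × X → ℂ) :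
    X → X → ℂ := fun x x' =>
  G (none, x) (none, x') - ∑ i, ∑ j, pt x i * conj (pt x' j) * G (some i, x) (some j, x')

/-- The Agler cone of kernels on the points `pt`. -/
def aglerCone (μ : MatrixNorms n) (pt : X → Fin n → ℂ) : Set (X → X → ℂ) :=
  aglerKernel pt '' {G | IsAglerGram μ G}

theorem continuous_aglerKernel (pt : X → Fin n → ℂ) : Continuous (aglerKernel pt) := by
  unfold aglerKernel
  fun_prop

theorem add_mem_aglerCone {μ : MatrixNorms n} {pt : X → Fin n → ℂ} {k k' : X → X → ℂ}
    (hk : k ∈ aglerCone μ pt) (hk' : k' ∈ aglerCone μ pt) : k + k' ∈ aglerCone μ pt := by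
  obtain ⟨G, hG, rfl⟩ := hk
  obtain ⟨G', hG', rfl⟩ := hk'
  refine ⟨G + G', hG.add hG', ?_⟩
  ext x x'
  simp only [aglerKernel, Pi.add_apply, mul_add, Finset.sum_add_distrib]
  ring

theorem smul_mem_aglerCone {μ : MatrixNorms n} {pt : X → Fin n → ℂ} {k : X → X → ℂ}
    (hk : k ∈ aglerCone μ pt) {r : ℝ} (hr : 0 ≤ r) : r • k ∈ aglerCone μ pt := by
  obtain ⟨G, hG, rfl⟩ := hk
  refine ⟨r • G, hG.smul hr, ?_⟩
  ext x x'
  simp only [aglerKernel, Pi.smul_apply, smul_sub, Finset.smul_sum, mul_smul_comm]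

/-- The contractivity condition for a family of vectors `f_x = v (none, x)`,
`g_{t,x} = v (some t, x)`. -/
def VectorsContractive (μ : MatrixNorms n) {K : Type*} [NormedAddCommGroup K]
    [InnerProductSpace ℂ K] (v : Option (Fin n) × X → K) : Prop :=
  ∀ (k l : ℕ) (A : Fin n → Matrix (Fin k) (Fin l) ℂ) (c : Fin k → X →₀ ℂ),
    ∑ b, ‖∑ t, ∑ a, conj (A t a b) •
        Finsupp.linearCombination ℂ (fun x => v (some t, x)) (c a)‖ ^ 2 ≤
      μ k l A ^ 2 * ∑ a, ‖Finsupp.linearCombination ℂ (fun x => v (none, x)) (c a)‖ ^ 2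

theorem linearCombination_block {K : Type*} [NormedAddCommGroup K] [InnerProductSpace ℂ K]
    (v : Option (Fin n) × X → K) (o : Option (Fin n)) (c : X →₀ ℂ) :
    Finsupp.linearCombination ℂ v (block o c) =
      Finsupp.linearCombination ℂ (fun x => v (o, x)) c :=
  Finsupp.linearCombination_mapDomain ℂ _ _

theorem isAglerGram_inner_iff {μ : MatrixNorms n} {K : Type*} [NormedAddCommGroup K]
    [InnerProductSpace ℂ K] {v : Option (Fin n) × X → K} :
    IsAglerGram μ (fun y y' => inner ℂ (v y) (v y')) ↔ VectorsContractive μ v := by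
  have hsq : ∀ x : K, (inner ℂ x x).re = ‖x‖ ^ 2 := fun x => inner_self_eq_norm_sq (𝕜 := ℂ) x
  have h : ∀ {k l : ℕ} (A : Fin n → Matrix (Fin k) (Fin l) ℂ) (c : Fin k → X →₀ ℂ) (b : Fin l),
      Finsupp.linearCombination ℂ v (adjointRow A c b) = ∑ t, ∑ a, conj (A t a b) •
        Finsupp.linearCombination ℂ (fun x => v (some t, x)) (c a) := fun A c b => by
    simp only [adjointRow, map_sum, map_smul, linearCombination_block]
  constructor
  · intro hG k l A c
    have := hG.contractive k l A c
    simpa only [gramForm_inner, hsq, h, linearCombination_block] using this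
  · intro hv
    refine ⟨fun y y' => inner_conj_symm _ _, fun c => ?_, fun k l A c => ?_⟩
    · rw [gramForm_inner, hsq]
      positivity
    · simpa only [gramForm_inner, hsq, h, linearCombination_block] using hv k l A c

/-- The Hilbert space is the completion of finitely supported vectors under the form with matrix
`G`, and the vectors are the images of the point masses. -/
theorem IsAglerGram.exists_vectors {μ : MatrixNorms n}
    {G : Option (Fin n) × X → Option (Fin n) × X → ℂ} (hG : IsAglerGram μ G) :
    ∃ (K : Type u) (_ : NormedAddCommGroup K) (_ : InnerProductSpace ℂ K) (_ : CompleteSpace K)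
      (v : Option (Fin n) × X → K), (∀ y y', inner ℂ (v y) (v y') = G y y') ∧
        VectorsContractive μ v := by
  let core : PreInnerProductSpace.Core ℂ (Option (Fin n) × X →₀ ℂ) :=
    { inner := gramForm G
      conj_inner_symm := gramForm_conj hG.herm
      re_inner_nonneg := hG.nonneg
      add_left := gramForm_add_left G
      smul_left := fun c d r => gramForm_smul_left G r c d }
  obtain ⟨K, i1, i2, i3, f, -, hf⟩ := exists_hilbertSpace_of_core core
  have hv : ∀ y y', inner ℂ (f (Finsupp.single y 1)) (f (Finsupp.single y' 1)) = G y y' := by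
    intro y y'
    rw [hf]
    change gramForm G _ _ = _
    rw [gramForm_eq_sum, Finsupp.sum_single_index (by simp), Finsupp.sum_single_index (by simp)]
    simp
  refine ⟨K, i1, i2, i3, fun y => f (Finsupp.single y 1), hv, ?_⟩
  rw [← isAglerGram_inner_iff]
  simpa only [hv] using hG

theorem inner_sum_conj_smul {K : Type*} [NormedAddCommGroup K] [InnerProductSpace ℂ K]
    (z w : Fin n → ℂ) (g h : Fin n → K) :
    inner ℂ (∑ i, conj (z i) • g i) (∑ j, conj (w j) • h j) =
      ∑ i, ∑ j, z i * conj (w j) * inner ℂ (g i) (h j) := by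
  simp only [sum_inner, inner_sum, inner_smul_left, inner_smul_right, RCLike.conj_conj,
    Finset.mul_sum]
  rw [Finset.sum_comm]
  refine Finset.sum_congr rfl fun i _ => Finset.sum_congr rfl fun j _ => ?_
  ring

theorem mem_aglerCone_of_vectors {μ : MatrixNorms n} {pt : X → Fin n → ℂ} {K : Type*}
    [NormedAddCommGroup K] [InnerProductSpace ℂ K] {v : Option (Fin n) × X → K}
    (hv : VectorsContractive μ v) :
    (fun x x' => inner ℂ (v (none, x)) (v (none, x')) -
      inner ℂ (∑ i, conj (pt x i) • v (some i, x)) (∑ j, conj (pt x' j) • v (some j, x'))) ∈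
        aglerCone μ pt := by
  refine ⟨_, isAglerGram_inner_iff.2 hv, ?_⟩
  ext x x'
  rw [aglerKernel, inner_sum_conj_smul]

theorem VectorsContractive.norm_sq_le {φ : (Fin n → ℂ) →ₗ[ℂ] (H →L[ℂ] H)} {K : Type*}
    [NormedAddCommGroup K] [InnerProductSpace ℂ K] {v : Option (Fin n) × X → K}
    (hv : VectorsContractive (matrixNorms φ) v) (z : Fin n → ℂ) (c : X →₀ ℂ) :
    ‖∑ t, conj (z t) • Finsupp.linearCombination ℂ (fun x => v (some t, x)) c‖ ^ 2 ≤
      ‖φ z‖ ^ 2 * ‖Finsupp.linearCombination ℂ (fun x => v (none, x)) c‖ ^ 2 := by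
  have := hv 1 1 (fun t => Matrix.of fun _ _ => z t) fun _ => c
  rw [matrixNorms_scalar] at this
  simpa using this

/-- The operator space Agler factorization of a kernel in the Agler cone. -/
theorem exists_factorization_of_mem_aglerCone {φ : (Fin n → ℂ) →ₗ[ℂ] (H →L[ℂ] H)}
    {pt : X → Fin n → ℂ} {q : X → X → ℂ} (hq : q ∈ aglerCone (matrixNorms φ) pt) :
    ∃ (K : Type u) (_ : NormedAddCommGroup K) (_ : InnerProductSpace ℂ K) (_ : CompleteSpace K)
      (σ : (Fin n → ℂ) →ₗ[ℂ] (K →L[ℂ] K)) (f : X → K),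
      CompletelyContractive (matrixNorms φ) σ ∧ ∀ x x', q x x' = inner ℂ (f x) (f x') -
        inner ℂ ((σ (pt x)).adjoint (f x)) ((σ (pt x')).adjoint (f x')) := by
  obtain ⟨G, hG, rfl⟩ := hq
  obtain ⟨K, i1, i2, i3, v, hvG, hv⟩ := IsAglerGram.exists_vectors hG
  set a := Finsupp.linearCombination ℂ fun x => v (none, x) with ha
  set b := fun t => Finsupp.linearCombination ℂ fun x => v (some t, x) with hb
  have hbound : ∀ t c, ‖b t c‖ ≤ ‖φ (Pi.single t 1)‖ * ‖a c‖ := by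
    intro t c
    have := hv.norm_sq_le (Pi.single t 1) c
    rw [Finset.sum_eq_single t (fun s _ hs => by simp [hs]) (by simp), Pi.single_eq_same, map_one,
      one_smul, ← mul_pow] at this
    exact le_of_sq_le_sq this (by positivity)
  choose T hT hTP using fun t => exists_extension_by_zero a (b t) (hbound t)
  set M := (LinearMap.range a).topologicalClosure with hM
  have hadj : ∀ z, (tupleMap (fun t => (T t).adjoint) z).adjoint = ∑ t, conj (z t) • T t := by
    intro z
    simp only [tupleMap, Fintype.linearCombination_apply, map_sum, map_smulₛₗ,
      ContinuousLinearMap.adjoint_adjoint]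
  have hsingle : ∀ t, tupleMap (fun t => (T t).adjoint) (Pi.single t 1) = (T t).adjoint := by
    intro t
    rw [tupleMap, Fintype.linearCombination_apply_single, one_smul]
  refine ⟨K, i1, i2, i3, tupleMap fun t => (T t).adjoint, fun x => v (none, x), ?_, ?_⟩
  · intro k l A
    simp only [hsingle]
    rw [norm_tensorSum_le_iff_adjoint _ _ (matrixNorms_nonneg φ A)]
    simp only [ContinuousLinearMap.adjoint_adjoint]
    have hclosed : IsClosed {u : Fin k → K | ∑ j, ‖∑ t, ∑ i, conj (A t i j) • T t (u i)‖ ^ 2 ≤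
        matrixNorms φ k l A ^ 2 * ∑ i, ‖u i‖ ^ 2} :=
      isClosed_le (by fun_prop) (by fun_prop)
    -- On the range of `a` the bound is contractivity of the vectors. It extends to the closure `M`
    -- by continuity, and then to `K` because each `T t` vanishes on the orthogonal complement of
    -- `M`.
    have hM' : ∀ u : Fin k → K, (∀ i, u i ∈ M) →
        ∑ j, ‖∑ t, ∑ i, conj (A t i j) • T t (u i)‖ ^ 2 ≤
          matrixNorms φ k l A ^ 2 * ∑ i, ‖u i‖ ^ 2 := by
      intro u hu
      have hu' : u ∈ closure (Set.univ.pi fun _ : Fin k => (LinearMap.range a : Set K)) := by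
        rw [closure_pi_set]
        exact fun i _ => hu i
      refine closure_minimal (fun w hw => ?_) hclosed hu'
      choose c hc using fun i => hw i (Set.mem_univ i)
      obtain rfl : (fun i => a (c i)) = w := funext hc
      simp only [Set.mem_ofPred_eq, hT]
      exact hv k l A c
    intro u
    have h1 := hM' (fun i => M.starProjection (u i)) fun i => M.starProjection_apply_mem _
    simp only [hM, hTP] at h1
    refine h1.trans ?_
    gcongr with i
    exact Submodule.norm_starProjection_apply_le _ _
  · intro x x'
    have hTv : ∀ t x, T t (v (none, x)) = v (some t, x) := by
      intro t x
      have := hT t (Finsupp.single x 1)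
      simpa only [ha, hb, Finsupp.linearCombination_single, one_smul] using this
    simp only [hadj, sum_apply, smul_apply, hTv, inner_sum_conj_smul, hvG]
    rfl

/-- The diagonal of the kernel is at least `(1 - ‖φ(pt x)‖²) ‖f_x‖²`, with a positive factor since
the points lie in the open ball. So it controls `f_x`, hence `g_{t,x}`, and by Cauchy–Schwarz all
entries. -/
theorem norm_gram_le {φ : (Fin n → ℂ) →ₗ[ℂ] (H →L[ℂ] H)} {pt : X → Fin n → ℂ}
    (hpt : ∀ x, pt x ∈ unitBall φ) : ∃ β : Option (Fin n) × X → ℝ, (∀ y, 0 ≤ β y) ∧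
      ∀ G, IsAglerGram (matrixNorms φ) G → ∀ y y', ‖G y y'‖ ≤
        β y * (aglerKernel pt G y.2 y.2).re + β y' * (aglerKernel pt G y'.2 y'.2).re := by
  have hpos : ∀ x, 0 < 1 - ‖φ (pt x)‖ ^ 2 := by
    intro x
    have h : ‖φ (pt x)‖ < 1 := hpt x
    nlinarith [norm_nonneg (φ (pt x))]
  set C : Option (Fin n) → ℝ := fun o => o.elim 1 fun t => ‖φ (Pi.single t 1)‖ ^ 2 with hC
  have hC0 : ∀ o, 0 ≤ C o := by
    rintro (_ | t)
    · exact zero_le_one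
    · exact sq_nonneg _
  refine ⟨fun y => C y.1 * (1 - ‖φ (pt y.2)‖ ^ 2)⁻¹,
    fun y => mul_nonneg (hC0 _) (inv_nonneg.2 (hpos _).le), fun G hG y y' => ?_⟩
  obtain ⟨K, i1, i2, i3, v, hvG, hv⟩ := hG.exists_vectors
  have h1 : ∀ o x, ‖v (o, x)‖ ^ 2 ≤ C o * ‖v (none, x)‖ ^ 2 := by
    rintro (_ | t) x
    · exact (one_mul _).ge
    · have := hv.norm_sq_le (Pi.single t 1) (Finsupp.single x 1)
      rw [Finset.sum_eq_single t (fun s _ hs => by simp [hs]) (by simp), Pi.single_eq_same,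
        map_one, one_smul] at this
      simp only [Finsupp.linearCombination_single, one_smul] at this
      exact this
  have h2 : ∀ x, ‖v (none, x)‖ ^ 2 ≤ (1 - ‖φ (pt x)‖ ^ 2)⁻¹ * (aglerKernel pt G x x).re := by
    intro x
    rw [le_inv_mul_iff₀ (hpos x)]
    have h3 := hv.norm_sq_le (pt x) (Finsupp.single x 1)
    simp only [Finsupp.linearCombination_single, one_smul] at h3
    have h4 : aglerKernel pt G x x = inner ℂ (v (none, x)) (v (none, x)) -
        inner ℂ (∑ i, conj (pt x i) • v (some i, x)) (∑ j, conj (pt x j) • v (some j, x)) := by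
      rw [inner_sum_conj_smul, aglerKernel]
      simp only [hvG]
    have hsq : ∀ x : K, (inner ℂ x x).re = ‖x‖ ^ 2 := fun x => inner_self_eq_norm_sq (𝕜 := ℂ) x
    rw [h4, Complex.sub_re, hsq, hsq]
    linarith
  have h5 : ∀ y : Option (Fin n) × X, ‖v y‖ ^ 2 ≤
      C y.1 * (1 - ‖φ (pt y.2)‖ ^ 2)⁻¹ * (aglerKernel pt G y.2 y.2).re := fun y =>
    (h1 y.1 y.2).trans (by rw [mul_assoc]; exact mul_le_mul_of_nonneg_left (h2 _) (hC0 _))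
  rw [← hvG]
  have h6 := norm_inner_le_norm (𝕜 := ℂ) (v y) (v y')
  nlinarith [h5 y, h5 y', sq_nonneg (‖v y‖ - ‖v y'‖), sq_nonneg ‖v y‖, sq_nonneg ‖v y'‖]

/-- Gram matrices of kernels converging to `q` are eventually bounded entry by entry, so they
converge along an ultrafilter; the limit is again an Agler Gram matrix, with kernel `q`.
Ultrafilters serve because `X` may be uncountable. -/
theorem isClosed_aglerCone {φ : (Fin n → ℂ) →ₗ[ℂ] (H →L[ℂ] H)} {pt : X → Fin n → ℂ}
    (hpt : ∀ x, pt x ∈ unitBall φ) : IsClosed (aglerCone (matrixNorms φ) pt) := by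
  obtain ⟨β, hβ0, hβ⟩ := norm_gram_le (H := H) hpt
  refine isClosed_of_closure_subset fun q hq => ?_
  obtain ⟨F, hF, hFq⟩ := mem_closure_iff_ultrafilter.1 hq
  have hch : ∀ q' : X → X → ℂ, ∃ G, q' ∈ aglerCone (matrixNorms φ) pt →
      IsAglerGram (matrixNorms φ) G ∧ aglerKernel pt G = q' := by
    intro q'
    by_cases h : q' ∈ aglerCone (matrixNorms φ) pt
    · obtain ⟨G, hG, hG'⟩ := h
      exact ⟨G, fun _ => ⟨hG, hG'⟩⟩
    · exact ⟨0, fun h' => absurd h' h⟩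
  choose g hg using hch
  have hgF : ∀ᶠ q' in (F : Filter (X → X → ℂ)), IsAglerGram (matrixNorms φ) (g q') ∧
      aglerKernel pt (g q') = q' := by
    filter_upwards [hF] with q' hq' using hg q' hq'
  have hlim : ∀ y y', ∃ l, Tendsto (fun q' => g q' y y') F (𝓝 l) := by
    intro y y'
    have hre : ∀ x, ∀ᶠ q' in (F : Filter (X → X → ℂ)), (q' x x).re ≤ (q x x).re + 1 := by
      intro x
      have hc : Tendsto (fun q' : X → X → ℂ => (q' x x).re) F (𝓝 (q x x).re) :=
        (Continuous.tendsto (by fun_prop) q).mono_left hFq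
      exact hc.eventually_le_const (lt_add_one _)
    have hball : ∀ᶠ q' in (F : Filter (X → X → ℂ)), g q' y y' ∈ Metric.closedBall (0 : ℂ)
        (β y * ((q y.2 y.2).re + 1) + β y' * ((q y'.2 y'.2).re + 1)) := by
      filter_upwards [hgF, hre y.2, hre y'.2] with q' h1 h2 h3
      rw [mem_closedBall_zero_iff]
      have h4 := hβ _ h1.1 y y'
      rw [h1.2] at h4
      exact h4.trans (add_le_add (mul_le_mul_of_nonneg_left h2 (hβ0 y))
        (mul_le_mul_of_nonneg_left h3 (hβ0 y')))
    obtain ⟨l, -, hl⟩ := (isCompact_closedBall (0 : ℂ) _).ultrafilter_le_nhds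
      (F.map fun q' => g q' y y') (le_principal_iff.2 hball)
    exact ⟨l, hl⟩
  choose G hG using hlim
  have hGt : Tendsto g F (𝓝 G) :=
    tendsto_pi_nhds.2 fun y => tendsto_pi_nhds.2 fun y' => hG y y'
  refine ⟨G, (isClosed_isAglerGram _).mem_of_tendsto hGt (hgF.mono fun _ h => h.1), ?_⟩
  have h1 : Tendsto (fun q' => aglerKernel pt (g q')) F (𝓝 (aglerKernel pt G)) :=
    ((continuous_aglerKernel pt).tendsto G).comp hGt
  have h2 : Tendsto (fun q' => aglerKernel pt (g q')) F (𝓝 q) :=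
    Tendsto.congr' (hgF.mono fun _ h => h.2.symm) (tendsto_id'.2 hFq)
  exact tendsto_nhds_unique h1 h2

end AglerCone

/-! ### Separation from the cone and the resulting commuting tuple -/

section Separation

open scoped ComplexConjugate

variable {n : ℕ} {X : Type u} {H : Type v} [NormedAddCommGroup H] [InnerProductSpace ℂ H]

open scoped Matrix.Norms.L2Operator in
/-- Scalar functions give families of vectors that are contractive for `E`, with the constants
supplied by the norms of the dual operator space. -/
theorem vectorsContractive_of_functions {φ : (Fin n → ℂ) →ₗ[ℂ] (H →L[ℂ] H)}
    (hφ : Function.Injective φ) {k l : ℕ} (A : Fin n → Matrix (Fin k) (Fin l) ℂ)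
    (u : Fin k → X → ℂ) {v : Option (Fin n) × X → EuclideanSpace ℂ (Fin k ⊕ Fin l)}
    (hv : ∀ x, v (none, x) = WithLp.toLp 2
      (Sum.elim (fun a => (dualNorms (matrixNorms φ) k l A : ℂ) * u a x) fun _ => 0))
    (hv' : ∀ t x, v (some t, x) = WithLp.toLp 2
      (Sum.elim (fun _ => 0) fun b => ∑ a, conj (A t a b) * u a x)) :
    VectorsContractive (matrixNorms φ) v := by
  intro r s C c
  set d := dualNorms (matrixNorms φ) k l A with hd
  set y : Fin k × Fin r → ℂ := fun q => Finsupp.linearCombination ℂ (u q.1) (c q.2) with hy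
  have hcoord : ∀ (w : X → EuclideanSpace ℂ (Fin k ⊕ Fin l)) (e : X →₀ ℂ) (o : Fin k ⊕ Fin l),
      Finsupp.linearCombination ℂ w e o = Finsupp.linearCombination ℂ (fun x => w x o) e :=
    fun w e o => Finsupp.apply_linearCombination ℂ
      (EuclideanSpace.proj (𝕜 := ℂ) o : EuclideanSpace ℂ (Fin k ⊕ Fin l) →L[ℂ] ℂ).toLinearMap w e
  have h1 : ∀ a', ‖Finsupp.linearCombination ℂ (fun x => v (none, x)) (c a')‖ ^ 2 =
      d ^ 2 * ∑ a, ‖y (a, a')‖ ^ 2 := by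
    intro a'
    rw [EuclideanSpace.norm_sq_eq, Fintype.sum_sum_type, Finset.mul_sum]
    simp only [hcoord, hv, Sum.elim_inl, Sum.elim_inr, hy]
    simp only [Finsupp.linearCombination_apply, Finsupp.sum, smul_eq_mul, mul_zero,
      Finset.sum_const_zero, norm_zero, mul_left_comm _ (d : ℂ), ← Finset.mul_sum, norm_mul,
      mul_pow, Complex.norm_real, Real.norm_eq_abs, sq_abs]
    simp
  have h2 : ∀ t a' b, Finsupp.linearCombination ℂ (fun x => v (some t, x)) (c a') (Sum.inr b) =
      ∑ a, conj (A t a b) * y (a, a') := by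
    intro t a' b
    simp only [hcoord, hv', Sum.elim_inr, hy]
    simp only [Finsupp.linearCombination_apply, Finsupp.sum, smul_eq_mul, Finset.mul_sum]
    rw [Finset.sum_comm]
    refine Finset.sum_congr rfl fun a _ => Finset.sum_congr rfl fun x _ => ?_
    ring
  have h3 : ∀ t a' b, Finsupp.linearCombination ℂ (fun x => v (some t, x)) (c a') (Sum.inl b) =
      0 := by
    intro t a' b
    simp only [hcoord, hv', Sum.elim_inl]
    simp [Finsupp.linearCombination_apply]
  -- The required bound is that of the adjoint of `∑ A_t ⊗ C_t`, whose norm the duality inequality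
  -- estimates.
  have h4 := (l2_opNorm_le_iff (∑ t, A t ⊗ₖ C t).conjTranspose
    (mul_nonneg (dualNorms_nonneg _ A) (matrixNorms_nonneg φ C))).1
    ((Matrix.l2_opNorm_conjTranspose _).trans_le (norm_kronecker_le_dualNorms hφ A C)) y
  simp only [h1, ← Finset.mul_sum]
  rw [mul_pow, Fintype.sum_prod_type, Fintype.sum_prod_type, Finset.sum_comm] at h4
  rw [← mul_assoc, mul_comm (matrixNorms φ r s C ^ 2), Finset.sum_comm]
  refine le_trans (le_of_eq ?_) h4
  refine Finset.sum_congr rfl fun b' _ => ?_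
  rw [EuclideanSpace.norm_sq_eq, Fintype.sum_sum_type]
  simp only [WithLp.ofLp_sum, WithLp.ofLp_smul, Finset.sum_apply, Pi.smul_apply, h2, h3,
    Matrix.conjTranspose_apply, Matrix.sum_apply,
    Matrix.kroneckerMap_apply, RCLike.star_def, map_sum, map_mul, smul_eq_mul]
  rw [Finset.sum_eq_zero (fun _ _ => by norm_num), zero_add]
  refine Finset.sum_congr rfl fun b _ => ?_
  congr 2
  simp only [Fintype.sum_prod_type, Finset.sum_mul, Finset.mul_sum]
  rw [Finset.sum_comm_cycle]
  refine Finset.sum_congr rfl fun a _ => ?_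
  rw [Finset.sum_comm]
  refine Finset.sum_congr rfl fun a' _ => Finset.sum_congr rfl fun t _ => ?_
  ring

/-- The rank one kernel `conj (f x) * g x'`. -/
def rankOne (f g : X → ℂ) : X → X → ℂ := fun x x' => conj (f x) * g x'

/-- The vectors `f_x` and `g_{t,x}` are placed in separate blocks, with `f_x` scaled by the dual
norm of `A`. Positivity of a functional on these kernels is exactly the complete contractivity for
the dual that the constructed tuple needs. -/
theorem sub_mem_aglerCone {φ : (Fin n → ℂ) →ₗ[ℂ] (H →L[ℂ] H)} (hφ : Function.Injective φ)
    (pt : X → Fin n → ℂ) {k l : ℕ} (A : Fin n → Matrix (Fin k) (Fin l) ℂ) (u : Fin k → X → ℂ)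
    {w : Fin l → X → ℂ}
    (hw : ∀ b x, w b x = ∑ t, ∑ a, conj (A t a b) * (conj (pt x t) * u a x)) :
    (dualNorms (matrixNorms φ) k l A ^ 2 : ℝ) • ∑ a, rankOne (u a) (u a) -
      ∑ b, rankOne (w b) (w b) ∈ aglerCone (matrixNorms φ) pt := by
  let v : Option (Fin n) × X → EuclideanSpace ℂ (Fin k ⊕ Fin l) := fun q => q.1.elim
    (WithLp.toLp 2 (Sum.elim (fun a => (dualNorms (matrixNorms φ) k l A : ℂ) * u a q.2) fun _ => 0))
    fun t => WithLp.toLp 2 (Sum.elim (fun _ => 0) fun b => ∑ a, conj (A t a b) * u a q.2)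
  have h := mem_aglerCone_of_vectors (pt := pt)
    (vectorsContractive_of_functions hφ A u (v := v) (fun _ => rfl) fun _ _ => rfl)
  convert h using 1
  have hs : ∀ x, ∑ i, conj (pt x i) • v (some i, x) = WithLp.toLp 2 (Sum.elim (fun _ => 0) fun b => w b x) := by
    intro x
    ext (a | b)
    · simp [v]
    · simp only [v, Option.elim_some, hw, WithLp.ofLp_sum, WithLp.ofLp_smul, Finset.sum_apply,
        Pi.smul_apply, Sum.elim_inr, smul_eq_mul, Finset.mul_sum]
      refine Finset.sum_congr rfl fun t _ => Finset.sum_congr rfl fun a _ => ?_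
      ring
  ext x x'
  simp only [hs, v, Option.elim_none, PiLp.inner_apply, Fintype.sum_sum_type, Sum.elim_inl,
    Sum.elim_inr, RCLike.inner_apply, map_zero, mul_zero,
    Finset.sum_const_zero, add_zero, zero_add, Pi.sub_apply, Pi.smul_apply, Finset.sum_apply,
    rankOne, map_mul, Complex.conj_ofReal, Complex.real_smul, Finset.mul_sum, Complex.ofReal_pow]
  congr 1
  · refine Finset.sum_congr rfl fun a _ => ?_
    ring
  · refine Finset.sum_congr rfl fun a _ => ?_
    ring

/-- A kernel outside the Agler cone is separated from it by the commuting tuple of a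
Gelfand--Naimark--Segal construction. -/
theorem exists_tuple_of_notMem_aglerCone {φ : (Fin n → ℂ) →ₗ[ℂ] (H →L[ℂ] H)}
    (hφ : Function.Injective φ) {pt : X → Fin n → ℂ} (hpt : ∀ x, pt x ∈ unitBall φ)
    {q : X → X → ℂ} (hq : q ∉ aglerCone (matrixNorms φ) pt) :
    ∃ (K : Type u) (_ : NormedAddCommGroup K) (_ : InnerProductSpace ℂ K) (_ : CompleteSpace K)
      (S : Fin n → K →L[ℂ] K) (ι : (X → ℂ) →ₗ[ℂ] K) (L : (X → X → ℂ) →L[ℂ] ℂ),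
      (∀ i j, Commute (S i) (S j)) ∧
      CompletelyContractive (dualNorms (matrixNorms φ)) (tupleMap S) ∧
      (∀ t u, (S t).adjoint (ι u) = ι fun x => conj (pt x t) * u x) ∧
      (∀ u, ‖ι u‖ ^ 2 = (L (rankOne u u)).re) ∧ (L q).re < 0 := by
  have hzero : (0 : X → X → ℂ) ∈ aglerCone (matrixNorms φ) pt := by
    have := sub_mem_aglerCone hφ pt (k := 0) (l := 0) (fun _ => 0) (fun _ => 0) (w := fun _ => 0)
      (fun b => b.elim0)
    simpa using this
  have hconv : Convex ℝ (aglerCone (matrixNorms φ) pt) := fun x hx y hy a b ha hb _ =>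
    add_mem_aglerCone (smul_mem_aglerCone hx ha) (smul_mem_aglerCone hy hb)
  obtain ⟨L, c, hLq, hLc⟩ := RCLike.geometric_hahn_banach_point_closed (𝕜 := ℂ) hconv
    (isClosed_aglerCone hpt) hq
  have hc : c < 0 := by simpa using hLc 0 hzero
  -- A negative value on the cone could be rescaled to equal `c`, against the strict separation.
  have hL : ∀ k ∈ aglerCone (matrixNorms φ) pt, 0 ≤ (L k).re := by
    intro k hk
    by_contra! hneg
    have h1 := hLc _ (smul_mem_aglerCone hk (div_nonneg_of_nonpos hc.le hneg.le))
    rw [← Complex.coe_smul, map_smul, smul_eq_mul, RCLike.re_eq_complex_re, Complex.re_ofReal_mul,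
      div_mul_cancel₀ _ hneg.ne] at h1
    exact lt_irrefl _ h1
  have hbound : ∀ {k l : ℕ} (A : Fin n → Matrix (Fin k) (Fin l) ℂ) (u : Fin k → X → ℂ)
      (w : Fin l → X → ℂ)
      (_ : ∀ b x, w b x = ∑ t, ∑ a, conj (A t a b) * (conj (pt x t) * u a x)),
      ∑ b, (L (rankOne (w b) (w b))).re ≤
        dualNorms (matrixNorms φ) k l A ^ 2 * ∑ a, (L (rankOne (u a) (u a))).re := by
    intro k l A u w hw
    have := hL _ (sub_mem_aglerCone hφ pt A u hw)
    rw [map_sub, ← Complex.coe_smul, map_smul, smul_eq_mul, Complex.sub_re, Complex.re_ofReal_mul,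
      map_sum, map_sum, Complex.re_sum, Complex.re_sum] at this
    linarith
  have hpos : ∀ u, 0 ≤ (L (rankOne u u)).re := by
    intro u
    -- With `f = u` and `g = 0` the kernel is `rankOne u u`, which therefore lies in the cone.
    let v : Option (Fin n) × X → ℂ := fun q => q.1.elim (u q.2) fun _ => 0
    have hv : VectorsContractive (matrixNorms φ) v := by
      intro k l A c
      have h0 : ∀ c, Finsupp.linearCombination ℂ (fun _ : X => (0 : ℂ)) c = 0 := fun c => by
        simp [Finsupp.linearCombination_apply]
      simp only [v, Option.elim_some, h0, smul_zero, Finset.sum_const_zero, norm_zero]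
      rw [Finset.sum_eq_zero fun _ _ => by norm_num]
      positivity
    convert hL _ (mem_aglerCone_of_vectors (pt := pt) hv) using 3
    ext x x'
    simp [v, rankOne, mul_comm]
  -- The functional `L` need not be Hermitian, so the form is symmetrized; its diagonal is the real
  -- part of `L`.
  let core : PreInnerProductSpace.Core ℂ (X → ℂ) :=
    { inner := fun f g => (L (rankOne f g) + conj (L (rankOne g f))) / 2
      conj_inner_symm := fun f g => by simp [add_comm, map_ofNat]
      re_inner_nonneg := fun f => by
        have : ((L (rankOne f f) + conj (L (rankOne f f))) / 2) = ((L (rankOne f f)).re : ℂ) := by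
          rw [Complex.add_conj]
          simp
        rw [this]
        exact hpos f
      add_left := fun f g h => by
        have h1 : rankOne (f + g) h = rankOne f h + rankOne g h := by
          ext; simp [rankOne, add_mul]
        have h2 : rankOne h (f + g) = rankOne h f + rankOne h g := by
          ext; simp [rankOne, mul_add]
        rw [h1, h2, map_add, map_add, map_add]
        ring
      smul_left := fun f g r => by
        have h1 : rankOne (r • f) g = conj r • rankOne f g := by
          ext; simp [rankOne, mul_assoc]
        have h2 : rankOne g (r • f) = r • rankOne g f := by
          ext; simp [rankOne, mul_left_comm]
        rw [h1, h2, map_smul, map_smul, smul_eq_mul, smul_eq_mul, map_mul]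
        ring }
  obtain ⟨K, i1, i2, i3, ι, hι, hin⟩ := exists_hilbertSpace_of_core core
  have hnorm : ∀ u, ‖ι u‖ ^ 2 = (L (rankOne u u)).re := by
    intro u
    rw [← inner_self_eq_norm_sq (𝕜 := ℂ), hin]
    change ((L (rankOne u u) + conj (L (rankOne u u))) / 2).re = _
    rw [Complex.add_conj]
    simp
  let m : Fin n → (X → ℂ) →ₗ[ℂ] (X → ℂ) := fun t => LinearMap.mulLeft ℂ fun x => conj (pt x t)
  -- The tuple of `1 × 1` matrices supported at `t` shows that multiplication by the conjugate of
  -- the coordinate `t` is bounded for the new norm, so it descends to `K`.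
  have hm : ∀ t u, ‖ι (m t u)‖ ≤ dualNorms (matrixNorms φ) 1 1
      (fun s => Matrix.of fun _ _ => if s = t then 1 else 0) * ‖ι u‖ := by
    intro t u
    refine le_of_sq_le_sq ?_ (mul_nonneg (dualNorms_nonneg _ _) (norm_nonneg _))
    rw [mul_pow, hnorm, hnorm]
    have := hbound (fun s => Matrix.of fun (_ : Fin 1) (_ : Fin 1) => if s = t then 1 else 0)
      (fun _ => u) (fun _ => m t u) (fun _ x => by simp [m])
    simpa using this
  choose T hT _ using fun t => exists_extension_by_zero ι (ι ∘ₗ m t) (hm t)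
  have hsingle : ∀ t, tupleMap (fun t => (T t).adjoint) (Pi.single t 1) = (T t).adjoint := by
    intro t
    rw [tupleMap, Fintype.linearCombination_apply_single, one_smul]
  refine ⟨K, i1, i2, i3, fun t => (T t).adjoint, ι, L, fun i j => ?_, ?_, fun t u => ?_, hnorm,
    hLq.trans hc⟩
  · have hcomm : T j ∘L T i = T i ∘L T j := by
      refine DFunLike.coe_injective (DenseRange.equalizer hι (T j ∘L T i).continuous
        (T i ∘L T j).continuous (funext fun u => ?_))
      change T j (T i (ι u)) = T i (T j (ι u))
      simp only [hT, LinearMap.comp_apply]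
      congr 1
      ext x
      simp only [m, LinearMap.mulLeft_apply, Pi.mul_apply]
      ring
    have := congrArg ContinuousLinearMap.adjoint hcomm
    rw [ContinuousLinearMap.adjoint_comp, ContinuousLinearMap.adjoint_comp] at this
    exact this
  · intro k l A
    simp only [hsingle]
    rw [norm_tensorSum_le_iff_adjoint _ _ (dualNorms_nonneg _ A)]
    simp only [ContinuousLinearMap.adjoint_adjoint]
    intro u
    have hd : DenseRange fun w : Fin k → X → ℂ => fun i => ι (w i) := DenseRange.piMap fun _ => hι
    refine hd.induction_on (p := fun u : Fin k → K => ∑ j, ‖∑ t, ∑ i, conj (A t i j) • T t (u i)‖ ^ 2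
      ≤ dualNorms (matrixNorms φ) k l A ^ 2 * ∑ i, ‖u i‖ ^ 2) u
      (isClosed_le (by fun_prop) (by fun_prop)) fun w => ?_
    have := hbound A w (fun b => ∑ t, ∑ a, conj (A t a b) • m t (w a)) fun b x => by
      simp [m, Finset.sum_apply]
    simpa only [← hnorm, map_sum, map_smul, hT, LinearMap.comp_apply] using this
  · rw [ContinuousLinearMap.adjoint_adjoint, hT]
    rfl

/-- The adjoints of the `S t` act on the image of `ι` as multiplications, so that of `q(S)`
multiplies by the conjugated values of `q`. -/
theorem adjoint_polyOp_apply {K : Type*} [NormedAddCommGroup K] [InnerProductSpace ℂ K]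
    [CompleteSpace K] {S : Fin n → K →L[ℂ] K} (hS : ∀ i j, Commute (S i) (S j))
    {pt : X → Fin n → ℂ} {ι : (X → ℂ) →ₗ[ℂ] K}
    (hι : ∀ t u, (S t).adjoint (ι u) = ι fun x => conj (pt x t) * u x)
    (q : MvPolynomial (Fin n) ℂ) (u : X → ℂ) :
    (polyOp q S).adjoint (ι u) = ι fun x => conj (MvPolynomial.eval (pt x) q) * u x := by
  obtain ⟨Ψ, hX, hΨ⟩ := exists_algHom_polyOp hS
  rw [← hΨ]
  induction q using MvPolynomial.induction_on generalizing u with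
  | C a =>
    have h1 : Ψ (MvPolynomial.C a) = a • ContinuousLinearMap.id ℂ K := by
      rw [← MvPolynomial.algebraMap_eq, AlgHom.commutes, Algebra.algebraMap_eq_smul_one]
      rfl
    rw [h1, map_smulₛₗ, ContinuousLinearMap.adjoint_id]
    change conj a • ι u = _
    rw [← map_smul]
    congr 1
    ext x
    simp
  | add p q hp hq =>
    rw [map_add, map_add, add_apply, hp, hq, ← map_add]
    refine congrArg ι (funext fun x => ?_)
    simp [add_mul]
  | mul_X p t hp =>
    rw [map_mul, hX]
    change (Ψ p ∘L S t).adjoint _ = _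
    rw [ContinuousLinearMap.adjoint_comp, ContinuousLinearMap.comp_apply, hp, hι]
    refine congrArg ι (funext fun x => ?_)
    simp only [map_mul, MvPolynomial.eval_X]
    ring

/-- The column on the left is `Y = M* e`, and Cauchy–Schwarz applies to `‖Y‖² = Re ⟨e, M Y⟩`. -/
theorem sum_norm_sq_adjoint_le_of_norm_opMatrix_le {K : Type*} [NormedAddCommGroup K]
    [InnerProductSpace ℂ K] [CompleteSpace K] {N : ℕ} {M : Matrix (Fin N) (Fin N) (K →L[ℂ] K)}
    (hM : ‖opMatrix M‖ ≤ 1) (e : Fin N → K) :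
    ∑ k, ‖∑ i, (M i k).adjoint (e i)‖ ^ 2 ≤ ∑ i, ‖e i‖ ^ 2 := by
  set E : PiLp 2 fun _ : Fin N => K := WithLp.toLp 2 e
  set Y : PiLp 2 fun _ : Fin N => K := WithLp.toLp 2 fun k => ∑ i, (M i k).adjoint (e i) with hY
  have h1 : ‖Y‖ ^ 2 = RCLike.re (inner ℂ E (opMatrix M Y)) := by
    rw [← inner_self_eq_norm_sq (𝕜 := ℂ)]
    congr 1
    rw [PiLp.inner_apply, PiLp.inner_apply]
    simp only [opMatrix_apply, inner_sum]
    rw [Finset.sum_comm]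
    refine Finset.sum_congr rfl fun k _ => ?_
    change inner ℂ (∑ i, (M i k).adjoint (e i)) (Y k) = _
    rw [sum_inner]
    exact Finset.sum_congr rfl fun i _ => ContinuousLinearMap.adjoint_inner_left _ _ _
  have h2 : ‖Y‖ ^ 2 ≤ ‖E‖ * ‖Y‖ := by
    rw [h1]
    refine (Complex.re_le_norm _).trans ((norm_inner_le_norm _ _).trans ?_)
    have := (opMatrix M).le_of_opNorm_le hM Y
    rw [one_mul] at this
    exact mul_le_mul_of_nonneg_left this (norm_nonneg _)
  have h3 : ‖Y‖ ^ 2 ≤ ‖E‖ ^ 2 := by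
    have hE := norm_nonneg E
    have hYn := norm_nonneg Y
    nlinarith [sq_nonneg (‖E‖ - ‖Y‖)]
  rwa [PiLp.norm_sq_eq_of_L2, PiLp.norm_sq_eq_of_L2] at h3

end Separation

/-! ### From the von Neumann inequality to a factorization -/

section Factorization

open scoped ComplexConjugate

variable {n N : ℕ} {H : Type v} [NormedAddCommGroup H] [InnerProductSpace ℂ H]

/-- The entry `(i, j)` of `1 - p(z) p(w)^*`. -/
theorem inner_single_one_sub_matPolyEval (p : Matrix (Fin N) (Fin N) (MvPolynomial (Fin n) ℂ))
    (z w : Fin n → ℂ) (i j : Fin N) :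
    inner ℂ (EuclideanSpace.single i (1 : ℂ))
      ((1 - matPolyEval p z ∘L (matPolyEval p w).adjoint) (EuclideanSpace.single j 1)) =
      (if i = j then 1 else 0) -
        ∑ k, MvPolynomial.eval z (p i k) * conj (MvPolynomial.eval w (p j k)) := by
  have h : ∀ k, (matPolyEval p w).adjoint (EuclideanSpace.single j 1) k =
      conj (MvPolynomial.eval w (p j k)) := by
    intro k
    rw [← matPolyEval_single p w j k, ← one_mul (((matPolyEval p w).adjoint _) k),
      ← map_one (starRingEnd ℂ), ← EuclideanSpace.inner_single_left,
      ContinuousLinearMap.adjoint_inner_right, EuclideanSpace.inner_single_right, map_one, one_mul]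
  have h' : ∀ x : EuclideanSpace ℂ (Fin N), matPolyEval p z x i =
      ∑ k, MvPolynomial.eval z (p i k) * x k := fun x => by
    simp [matPolyEval, Matrix.ofLp_toEuclideanCLM, Matrix.mulVec, dotProduct]
  rw [EuclideanSpace.inner_single_left, map_one, one_mul, sub_apply, PiLp.sub_apply,
    ContinuousLinearMap.comp_apply, h']
  simp only [h]
  congr 1
  simp

/-- The von Neumann inequality yields the Agler factorization. -/
theorem exists_factorization_of_norm_matPolyOp_le {φ : (Fin n → ℂ) →ₗ[ℂ] (H →L[ℂ] H)}
    (hφ : Function.Injective φ) (p : Matrix (Fin N) (Fin N) (MvPolynomial (Fin n) ℂ))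
    (hp : ∀ (K : Type u) [NormedAddCommGroup K] [InnerProductSpace ℂ K] [CompleteSpace K]
      (S : Fin n → (K →L[ℂ] K)), (∀ i j, Commute (S i) (S j)) →
      CompletelyContractive (dualNorms (matrixNorms φ)) (tupleMap S) → ‖matPolyOp p S‖ ≤ 1) :
    ∃ (K : Type u) (_ : NormedAddCommGroup K) (_ : InnerProductSpace ℂ K) (_ : CompleteSpace K)
      (σ : (Fin n → ℂ) →ₗ[ℂ] (K →L[ℂ] K))
      (F : (Fin n → ℂ) → (K →L[ℂ] EuclideanSpace ℂ (Fin N))),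
      CompletelyContractive (matrixNorms φ) σ ∧
      ∀ z ∈ unitBall φ, ∀ w ∈ unitBall φ,
        1 - matPolyEval p z ∘L (matPolyEval p w).adjoint =
          F z ∘L (1 - σ z ∘L (σ w).adjoint) ∘L (F w).adjoint := by
  classical
  -- A point of the index set is a point of the ball with a row index, which makes the matrix kernel
  -- scalar. The lift puts the Hilbert space built from `X` in the universe where `hp` applies.
  let X : Type u := ULift.{u} (unitBall φ × Fin N)
  let pt : X → Fin n → ℂ := fun x => x.down.1
  have hpt : ∀ x, pt x ∈ unitBall φ := fun x => x.down.1.2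
  let e : Fin N → X → ℂ := fun i x => if x.down.2 = i then 1 else 0
  let h : Fin N → X → ℂ := fun k x => conj (MvPolynomial.eval (pt x) (p x.down.2 k))
  have hq : ∑ i, rankOne (e i) (e i) - ∑ k, rankOne (h k) (h k) ∈
      aglerCone (matrixNorms φ) pt := by
    by_contra hq
    obtain ⟨K, i1, i2, i3, S, ι, L, hS, hSc, hadj, hnorm, hneg⟩ :=
      exists_tuple_of_notMem_aglerCone hφ hpt hq
    have h1 := sum_norm_sq_adjoint_le_of_norm_opMatrix_le (hp K S hS hSc) fun i => ι (e i)
    have h2 : ∀ k, ∑ i, ((p.map fun q => polyOp q S) i k).adjoint (ι (e i)) = ι (h k) := by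
      intro k
      simp only [Matrix.map_apply, adjoint_polyOp_apply hS hadj]
      rw [← map_sum]
      refine congrArg ι (funext fun x => ?_)
      simp [e, h]
    simp only [h2, hnorm] at h1
    rw [map_sub, map_sum, map_sum, Complex.sub_re, Complex.re_sum, Complex.re_sum] at hneg
    linarith
  obtain ⟨K, i1, i2, i3, σ, f, hσ, hf⟩ := exists_factorization_of_mem_aglerCone hq
  -- The factor is assembled point by point from the vectors `f`, without any regularity in `z`; the
  -- value outside the ball is irrelevant.
  let G : (Fin n → ℂ) → (EuclideanSpace ℂ (Fin N) →L[ℂ] K) := fun z =>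
    if hz : z ∈ unitBall φ then
      ∑ i, (EuclideanSpace.proj i : EuclideanSpace ℂ (Fin N) →L[ℂ] ℂ).smulRight
        (f ⟨⟨z, hz⟩, i⟩)
    else 0
  have hG : ∀ (z) (hz : z ∈ unitBall φ) (i : Fin N), G z (EuclideanSpace.single i 1) =
      f ⟨⟨z, hz⟩, i⟩ := by
    intro z hz i
    simp only [G, dif_pos hz, sum_apply, ContinuousLinearMap.smulRight_apply]
    rw [Finset.sum_eq_single i (fun k _ hk => by simp [hk]) (by simp)]
    simp
  refine ⟨K, i1, i2, i3, σ, fun z => (G z).adjoint, hσ, fun z hz w hw => ?_⟩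
  have hext : ∀ T T' : EuclideanSpace ℂ (Fin N) →L[ℂ] EuclideanSpace ℂ (Fin N),
      (∀ i j, inner ℂ (EuclideanSpace.single i (1 : ℂ)) (T (EuclideanSpace.single j 1)) =
        inner ℂ (EuclideanSpace.single i (1 : ℂ)) (T' (EuclideanSpace.single j 1))) → T = T' := by
    intro T T' hT
    refine ContinuousLinearMap.coe_injective
      ((EuclideanSpace.basisFun (Fin N) ℂ).toBasis.ext fun j => ?_)
    ext i
    simpa [EuclideanSpace.inner_single_left] using hT i j
  refine hext _ _ fun i j => ?_
  rw [inner_single_one_sub_matPolyEval, ContinuousLinearMap.adjoint_adjoint,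
    ContinuousLinearMap.comp_apply, ContinuousLinearMap.comp_apply,
    ContinuousLinearMap.adjoint_inner_right, hG z hz, hG w hw, sub_apply, inner_sub_right,
    ContinuousLinearMap.comp_apply, ← ContinuousLinearMap.adjoint_inner_left (σ z)]
  refine Eq.trans ?_ (hf ⟨⟨z, hz⟩, i⟩ ⟨⟨w, hw⟩, j⟩)
  simp [rankOne, e, h, pt, eq_comm]

end Factorization

end OpSpace

end

open OpSpace in
theorem theoremT {n N : ℕ}
    {H : Type v} [NormedAddCommGroup H] [InnerProductSpace ℂ H] [CompleteSpace H]
    (φ : (Fin n → ℂ) →ₗ[ℂ] (H →L[ℂ] H)) (hφ : Function.Injective φ)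
    (p : Matrix (Fin N) (Fin N) (MvPolynomial (Fin n) ℂ)) :
    List.TFAE [
      -- Agler--Nevanlinna factorization
      ∃ (K : Type u) (_ : NormedAddCommGroup K) (_ : InnerProductSpace ℂ K) (_ : CompleteSpace K)
        (σ : (Fin n → ℂ) →ₗ[ℂ] (K →L[ℂ] K))
        (F : (Fin n → ℂ) → (K →L[ℂ] EuclideanSpace ℂ (Fin N))),
        CompletelyContractive (matrixNorms φ) σ ∧
        AnalyticOnNhd ℂ F (unitBall φ) ∧
        ∀ z ∈ unitBall φ, ∀ w ∈ unitBall φ,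
          1 - matPolyEval p z ∘L (matPolyEval p w).adjoint =
            F z ∘L (1 - σ z ∘L (σ w).adjoint) ∘L (F w).adjoint,
      -- unitary transfer function realization
      ∃ (K : Type u) (_ : NormedAddCommGroup K) (_ : InnerProductSpace ℂ K) (_ : CompleteSpace K)
        (U : WithLp 2 (K × EuclideanSpace ℂ (Fin N)) ≃ₗᵢ[ℂ]
          WithLp 2 (K × EuclideanSpace ℂ (Fin N)))
        (A : K →L[ℂ] K) (B : EuclideanSpace ℂ (Fin N) →L[ℂ] K)
        (C : K →L[ℂ] EuclideanSpace ℂ (Fin N))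
        (D : EuclideanSpace ℂ (Fin N) →L[ℂ] EuclideanSpace ℂ (Fin N))
        (σ : (Fin n → ℂ) →ₗ[ℂ] (K →L[ℂ] K)),
        (∀ x y, U (WithLp.toLp 2 (x, y)) = WithLp.toLp 2 (A x + B y, C x + D y)) ∧
        CompletelyContractive (matrixNorms φ) σ ∧
        ∀ z ∈ unitBall φ,
          IsUnit (1 - σ z ∘L A) ∧
          matPolyEval p z = D + C ∘L Ring.inverse (1 - σ z ∘L A) ∘L σ z ∘L B,
      -- von Neumann inequality
      ∀ (K : Type u) [NormedAddCommGroup K] [InnerProductSpace ℂ K] [CompleteSpace K]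
        (S : Fin n → (K →L[ℂ] K)),
        (∀ i j, Commute (S i) (S j)) →
        CompletelyContractive (dualNorms (matrixNorms φ)) (tupleMap S) →
        ‖matPolyOp p S‖ ≤ 1
    ] := by
  tfae_have 1 → 2 := by
    rintro ⟨K, _, _, _, σ, F, hσ, -, hF⟩
    exact exists_realization_of_factorization hσ hF
  tfae_have 2 → 1 := by
    rintro ⟨K, _, _, _, U, A, B, C, D, σ, hU, hσ, hp⟩
    exact ⟨K, _, _, _, σ, fun z => C ∘L Ring.inverse (1 - σ z ∘L A), hσ,
      analyticOnNhd_resolvent σ A C fun z hz => (hp z hz).1, fun z hz w hw =>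
        factorization_of_realization U hU (hp z hz).1 (hp w hw).1 (hp z hz).2 (hp w hw).2⟩
  tfae_have 2 → 3 := by
    rintro ⟨K, _, _, _, U, A, B, C, D, σ, hU, hσ, hp⟩ L _ _ _ S hS hSc
    exact norm_matPolyOp_le_of_realization p U hU hσ hp hS hSc
  -- The factorization obtained here need not be analytic. The realization argument does not use
  -- analyticity, and the implication from 2 to 1 then provides an analytic factor.
  tfae_have 3 → 2 := by
    intro h
    obtain ⟨K, _, _, _, σ, F, hσ, hF⟩ := exists_factorization_of_norm_matPolyOp_le hφ p h
    exact exists_realization_of_factorization hσ hF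
  tfae_finish
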